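/- **Setting.** Let $\mathbb T^2=(\mathbb R/2\pi\mathbb Z)^2$, $e_n(x)=\frac1{2\pi}e^{in\cdot x}$ and $\langle n\rangle=(1+|n|^2)^{1/2}$ for $n\in\mathbb Z^2$, $\widehat f(n)=\int_{\mathbb T^2} f\,\overline{e_n}\,dx$, and $\|f\|_{H^s}=\|\langle n\rangle^s\widehat f(n)\|_{\ell^2(\mathbb Z^2)}$; the functions $v_0,v_1,v_N,z_N$ below are real-valued. Set $\mathcal H^1=H^1(\mathbb T^2)\times L^2(\mathbb T^2)$ and, for $T>0$, $X^1(T)=C([0,T];H^1(\mathbb T^2))\cap C^1([0,T];L^2(\mathbb T^2))$. On a probability space $(\Omega,\mathcal F,P)$ let $\{g_n\},\{h_n\}$, $n\in\mathbb Z^2$, be standard complex Gaussian variables ($g_0,h_0\sim\mathcal N_{\mathbb R}(0,1)$; for $n\ne0$ the real and imaginary parts are independent with law $\mathcal N_{\mathbb R}(0,\frac12)$), and let $\{\beta_n\}$ be complex Brownian motions with $\mathrm{Var}(\beta_n(t))=t$ ($\beta_0$ real), all mutually independent except for the constraints $g_{-n}=\overline{g_n}$, $h_{-n}=\overline{h_n}$,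 $\beta_{-n}=\overline{\beta_n}$. Put $W=\sum_n\beta_ne_n$. Let $\{\alpha_N\}_{N\ge1}$ be a bounded sequence of non-zero real numbers with $\alpha_N^2\log N\to\infty$ as $N\to\infty$. For $N\ge1$ let $\lambda_N>0$ be the unique solution of $$\lambda_N=\frac{3\alpha_N^2}{8\pi^2}\sum_{|n|\le N}\frac1{\lambda_N+|n|^2},\qquad\text{and set } \sigma_N=\tfrac13\lambda_N .$$ Let $\mathbf P_N$ be the projection onto the frequencies $|n|\le N$, let $\mathcal D_N(t)$ be the Fourier multiplier $$\mathcal D_N(t)=e^{-t/2}\,\frac{\sin\big(t\sqrt{\lambda_N-\frac14-\Delta}\big)}{\sqrt{\lambda_N-\frac14-\Delta}}$$ (the symbol $\sin(t\sqrt a)/\sqrt a$ is continued analytically to $a\le 0$), and let $$z_N(t)=\partial_t\mathcal D_N(t)z_{0,N}+\mathcal D_N(t)(z_{0,N}+z_{1,N})+\alpha_N\int_0^t\mathcal D_N(t-t')\,\mathbf P_N\,dW(t'),$$ $$z_{0,N}=\frac{\alpha_N}{\sqrt2}\sum_{|n|\le N}\frac{g_n}{\sqrt{\lambda_N+|n|^2}}\,e_n,\qquad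 z_{1,N}=\frac{\alpha_N}{\sqrt2}\sum_{|n|\le N}h_n\,e_n ,$$ with Wick powers $:\!z_N^2\!:\,=z_N^2-\sigma_N$ and $:\!z_N^3\!:\,=z_N^3-3\sigma_Nz_N$. Consider the Cauchy problem $$(\ast)\quad\begin{cases}(\partial_t^2-\Delta+\partial_t+\lambda_N)v_N+v_N^3+3v_N^2z_N+3v_N:\!z_N^2\!:+:\!z_N^3\!:\,=0\\ (v_N,\partial_tv_N)|_{t=0}=(v_0,v_1),\end{cases}$$ understood in the Duhamel formulation $$v_N(t)=\partial_t\mathcal D_N(t)v_0+\mathcal D_N(t)(v_0+v_1)-\int_0^t\mathcal D_N(t-t')\big(v_N^3+3v_N^2z_N+3v_N:\!z_N^2\!:+:\!z_N^3\!:\big)(t')\,dt'.$$ **Proposition.** $(\ast)$ is almost surely globally well-posed in $\mathcal H^1(\mathbb T^2)$, in the following sense. For every $T>0$ there is a measurable set $\Omega_T\subset\Omega$ with $P(\Omega_T)=1$ such that for every $\omega\in\Omega_T$, every integer $N\ge1$ and every $(v_0,v_1)\in\mathcal H^1(\mathbb T^2)$ there exists a unique solution $v_N\in X^1(T)$ to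 $(\ast)$ on $[0,T]$. -/

import Mathlib

open Set Filter Topology MeasureTheory ProbabilityTheory
open scoped NNReal ENNReal ComplexConjugate

noncomputable section

namespace TrivSNLW

/-! ### The torus, Fourier coefficients and Sobolev spaces -/

instance factTwoPiPos : Fact ((0 : ℝ) < 2 * Real.pi) := ⟨Real.two_pi_pos⟩

/-- The torus `𝕋² = (ℝ / 2πℤ)²`; its `volume` is Lebesgue measure, of total mass `(2π)²`. -/
abbrev Torus : Type := Fin 2 → AddCircle (2 * Real.pi)

/-- Spatial frequencies `n ∈ ℤ²`. -/
abbrev Freq : Type := Fin 2 → ℤ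

/-- The square `|n|²` of the Euclidean length of a frequency. -/
def freqSq (n : Freq) : ℝ := (n 0 : ℝ) ^ 2 + (n 1 : ℝ) ^ 2

/-- The finite set of frequencies `{n ∈ ℤ² : |n| ≤ N}`. -/
def freqBall (N : ℕ) : Finset Freq :=
  (Fintype.piFinset fun _ : Fin 2 => Finset.Icc (-(N : ℤ)) (N : ℤ)).filter
    fun n => (n 0) ^ 2 + (n 1) ^ 2 ≤ (N : ℤ) ^ 2

/-- The orthonormal Fourier basis `e_n(x) = (2π)⁻¹ e^{i n·x}` of `L²(𝕋²)`. -/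
def basisFn (n : Freq) (x : Torus) : ℂ :=
  ((2 * Real.pi : ℝ) : ℂ)⁻¹ * (fourier (n 0) (x 0) * fourier (n 1) (x 1))

/-- The Fourier coefficient `f̂(n) = ∫ f(x) conj(e_n(x)) dx` of a real-valued function. -/
def coeff (f : Torus → ℝ) (n : Freq) : ℂ :=
  ∫ x, (f x : ℂ) * conj (basisFn n x)

/-- The space `L²(𝕋²)` of real-valued functions. -/
abbrev L2 : Type := Lp ℝ 2 (volume : Measure Torus)

/-- The norm `‖f‖_{H^s} = ‖⟨n⟩^s f̂(n)‖_{ℓ²}`, `⟨n⟩ = (1 + |n|²)^{1/2}`, with values in `[0, ∞]`. -/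
def sobolevENorm (s : ℝ) (f : L2) : ℝ≥0∞ :=
  (∑' n : Freq, ENNReal.ofReal ((1 + freqSq n) ^ s * ‖coeff f n‖ ^ 2)) ^ (1 / 2 : ℝ)

/-- Membership in `H^s(𝕋²)` (for `s ≥ 0`, where `H^s ⊆ L²`). -/
def MemSobolev (s : ℝ) (f : L2) : Prop := sobolevENorm s f < ∞

/-- The space `X¹(T) = C([0,T]; H¹(𝕋²)) ∩ C¹([0,T]; L²(𝕋²))`. Only the values of the path `v` on
`[0,T]` matter. -/
structure MemX1 (T : ℝ) (v : ℝ → L2) : Prop where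
  mem_H1 : ∀ t ∈ Icc 0 T, MemSobolev 1 (v t)
  cont_H1 : ∀ t ∈ Icc 0 T,
    Tendsto (fun s => sobolevENorm 1 (v s - v t)) (𝓝[Icc 0 T] t) (𝓝 0)
  contDiff_L2 : ContDiffOn ℝ 1 v (Icc 0 T)

/-! ### The renormalization constant -/

theorem zero_mem_freqBall (N : ℕ) : (0 : Freq) ∈ freqBall N := by
  simp [freqBall, Fintype.mem_piFinset]

theorem freqSq_nonneg (n : Freq) : 0 ≤ freqSq n := by
  unfold freqSq; positivity

/-- For `a ≠ 0` there is exactly one `lam > 0` with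
`lam = (3 a² / (8 π²)) ∑_{|n| ≤ N} 1 / (lam + |n|²)`. -/
theorem existsUnique_renorm {a : ℝ} (ha : a ≠ 0) (N : ℕ) :
    ∃! lam : ℝ, 0 < lam ∧
      lam = 3 * a ^ 2 / (8 * Real.pi ^ 2) * ∑ n ∈ freqBall N, 1 / (lam + freqSq n) := by
  have hc : 0 < 3 * a ^ 2 / (8 * Real.pi ^ 2) := by positivity
  set c := 3 * a ^ 2 / (8 * Real.pi ^ 2)
  set K : ℝ := ((freqBall N).card : ℝ)
  have hK : 1 ≤ K := by
    have : 1 ≤ (freqBall N).card := Finset.card_pos.mpr ⟨0, zero_mem_freqBall N⟩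
    exact Nat.one_le_cast.mpr this
  have hanti : ∀ x y : ℝ, 0 < x → x ≤ y →
      c * ∑ n ∈ freqBall N, 1 / (y + freqSq n) ≤ c * ∑ n ∈ freqBall N, 1 / (x + freqSq n) := by
    intro x y hx hxy
    refine mul_le_mul_of_nonneg_left (Finset.sum_le_sum fun n _ => ?_) hc.le
    have := freqSq_nonneg n
    exact one_div_le_one_div_of_le (by linarith) (by linarith)
  have hlow : ∀ x : ℝ, 0 < x → c / x ≤ c * ∑ n ∈ freqBall N, 1 / (x + freqSq n) := by
    intro x hx
    have h1 : 1 / (x + freqSq 0) ≤ ∑ n ∈ freqBall N, 1 / (x + freqSq n) :=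
      Finset.single_le_sum (f := fun n => 1 / (x + freqSq n))
        (fun n _ => by have := freqSq_nonneg n; positivity) (zero_mem_freqBall N)
    have h2 : freqSq 0 = 0 := by simp [freqSq]
    rw [h2, add_zero] at h1
    calc c / x = c * (1 / x) := by ring
      _ ≤ _ := mul_le_mul_of_nonneg_left h1 hc.le
  have hup : ∀ x : ℝ, 0 < x → c * ∑ n ∈ freqBall N, 1 / (x + freqSq n) ≤ c * K / x := by
    intro x hx
    have h1 : ∑ n ∈ freqBall N, 1 / (x + freqSq n) ≤ ∑ _n ∈ freqBall N, 1 / x :=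
      Finset.sum_le_sum fun n _ =>
        one_div_le_one_div_of_le hx (by have := freqSq_nonneg n; linarith)
    rw [Finset.sum_const, nsmul_eq_mul] at h1
    calc _ ≤ c * (K * (1 / x)) := mul_le_mul_of_nonneg_left h1 hc.le
      _ = c * K / x := by ring
  have hx0 : 0 < √c := Real.sqrt_pos.mpr hc
  have hx1 : 0 < √(c * K) := Real.sqrt_pos.mpr (by positivity)
  have h01 : √c ≤ √(c * K) := Real.sqrt_le_sqrt (by nlinarith)
  have hcont : ContinuousOn
      (fun x : ℝ => x - c * ∑ n ∈ freqBall N, 1 / (x + freqSq n)) (Icc (√c) (√(c * K))) := by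
    refine continuousOn_id.sub (continuousOn_const.mul (continuousOn_finsetSum _ fun n _ => ?_))
    refine continuousOn_const.div (continuousOn_id.add continuousOn_const) fun x hx => ?_
    have := freqSq_nonneg n
    have h2 : 0 < x := hx0.trans_le hx.1
    have h3 : 0 < x + freqSq n := by linarith
    exact h3.ne'
  have hmem : (0 : ℝ) ∈ Icc (√c - c * ∑ n ∈ freqBall N, 1 / (√c + freqSq n))
      (√(c * K) - c * ∑ n ∈ freqBall N, 1 / (√(c * K) + freqSq n)) := by
    constructor
    · have := hlow _ hx0
      rw [Real.div_sqrt] at this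
      linarith
    · have := hup _ hx1
      rw [Real.div_sqrt] at this
      linarith
  obtain ⟨x, hx, hfx⟩ := intermediate_value_Icc h01 hcont hmem
  have hxpos : 0 < x := hx0.trans_le hx.1
  have hxeq : x = c * ∑ n ∈ freqBall N, 1 / (x + freqSq n) := by
    have hfx' : x - c * ∑ n ∈ freqBall N, 1 / (x + freqSq n) = 0 := hfx
    linarith
  refine ⟨x, ⟨hxpos, hxeq⟩, ?_⟩
  rintro y ⟨hy, hyeq⟩
  rcases le_total x y with h | h
  · have := hanti x y hxpos h
    linarith
  · have := hanti y x hy h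
    linarith

/-- The renormalization constant `λ_N`: the unique positive solution of
`λ_N = (3 α_N² / (8 π²)) ∑_{|n| ≤ N} 1 / (λ_N + |n|²)`, where `a = α_N ≠ 0`. -/
def renorm (a : ℝ) (N : ℕ) : ℝ :=
  if ha : a ≠ 0 then (existsUnique_renorm ha N).exists.choose else 0

/-- The variance `σ_N = E[z_{0,N}(x)²] = (α_N² / (8 π²)) ∑_{|n| ≤ N} 1 / (λ_N + |n|²)`. -/
def wickVar (a : ℝ) (N : ℕ) : ℝ :=
  a ^ 2 / (8 * Real.pi ^ 2) * ∑ n ∈ freqBall N, 1 / (renorm a N + freqSq n)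

/-! ### The propagator of the damped operator `∂_t² - Δ + ∂_t + λ` -/

/-- `sin(t √a) / √a`, read as `t` for `a = 0` and as `sinh(t √(-a)) / √(-a)` for `a < 0`: the
entire function of `a` that solves `s'' + a s = 0`, `s(0) = 0`, `s'(0) = 1` in `t`. -/
def sinRoot (a t : ℝ) : ℝ :=
  if 0 < a then Real.sin (t * √a) / √a
  else if a = 0 then t
  else Real.sinh (t * √(-a)) / √(-a)

/-- The symbol at the frequency `n` of
`𝒟(t) = e^{-t/2} sin(t √(λ - 1/4 - Δ)) / √(λ - 1/4 - Δ)`. -/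
def propSymbol (lam : ℝ) (n : Freq) (t : ℝ) : ℝ :=
  Real.exp (-t / 2) * sinRoot (lam - 1 / 4 + freqSq n) t

/-- The Fourier coefficient at `n` of the linear solution `∂_t𝒟(t) f₀ + 𝒟(t) (f₀ + f₁)`, where `a₀`
and `a₁` are the coefficients at `n` of the initial data `f₀` and `f₁`. -/
def linearFlow (lam : ℝ) (n : Freq) (a₀ a₁ : ℂ) (t : ℝ) : ℂ :=
  ((deriv (propSymbol lam n) t : ℝ) : ℂ) * a₀ + (propSymbol lam n t : ℂ) * (a₀ + a₁)

/-! ### The noise -/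

/-- A set of frequencies that contains `0` and exactly one of `n`, `-n` for each `n ≠ 0`. -/
abbrev HalfFreq : Type := {n : Freq // 0 < n 0 ∨ (n 0 = 0 ∧ 0 ≤ n 1)}

/-- `Z` is a standard complex Gaussian variable: its real and imaginary parts are independent
with law `N(0, 1/2)`. -/
def IsStdComplexGaussian {Ω : Type*} [MeasurableSpace Ω] (P : Measure Ω) (Z : Ω → ℂ) : Prop :=
  HasLaw (fun ω => (Z ω).re) (gaussianReal 0 (1 / 2)) P ∧
  HasLaw (fun ω => (Z ω).im) (gaussianReal 0 (1 / 2)) P ∧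
  IndepFun (fun ω => (Z ω).re) (fun ω => (Z ω).im) P

/-- `B` is a complex Brownian motion with `E|B(t)|² = t`: `√2 Re B` and `√2 Im B` are independent
standard real Brownian motions. -/
def IsComplexBrownian {Ω : Type*} [MeasurableSpace Ω] (P : Measure Ω)
    (B : ℝ≥0 → Ω → ℂ) : Prop :=
  IsBrownianReal (fun t ω => √2 * (B t ω).re) P ∧
  IsBrownianReal (fun t ω => √2 * (B t ω).im) P ∧
  IndepFun (fun ω t => (B t ω).re) (fun ω t => (B t ω).im) P

/-- The random inputs: `{g_n}`, `{h_n}` are standard complex Gaussian variables (real for `n = 0`)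
and `{β_n}` are complex Brownian motions with variance `t` (real for `n = 0`), mutually independent
up to the constraints `g_{-n} = conj g_n`, `h_{-n} = conj h_n`, `β_{-n} = conj β_n`. -/
structure IsNoise {Ω : Type*} [MeasurableSpace Ω] (P : Measure Ω)
    (g h : Freq → Ω → ℂ) (β : Freq → ℝ≥0 → Ω → ℂ) : Prop where
  measurable_g : ∀ n, Measurable (g n)
  measurable_h : ∀ n, Measurable (h n)
  measurable_β : ∀ n t, Measurable (β n t)
  g_neg : ∀ n ω, g (-n) ω = conj (g n ω)
  h_neg : ∀ n ω, h (-n) ω = conj (h n ω)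
  β_neg : ∀ n t ω, β (-n) t ω = conj (β n t ω)
  law_g_zero : HasLaw (fun ω => (g 0 ω).re) (gaussianReal 0 1) P
  law_h_zero : HasLaw (fun ω => (h 0 ω).re) (gaussianReal 0 1) P
  law_β_zero : IsBrownianReal (fun t ω => (β 0 t ω).re) P
  law_g : ∀ n, n ≠ 0 → IsStdComplexGaussian P (g n)
  law_h : ∀ n, n ≠ 0 → IsStdComplexGaussian P (h n)
  law_β : ∀ n, n ≠ 0 → IsComplexBrownian P (β n)
  indep : iIndep (Sum.elim
      (fun n : HalfFreq => MeasurableSpace.comap (g n) inferInstance)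
      (Sum.elim
        (fun n : HalfFreq => MeasurableSpace.comap (h n) inferInstance)
        (fun n : HalfFreq => MeasurableSpace.comap (fun ω t => β n t ω) MeasurableSpace.pi))) P

/-- The Wiener integral `∫₀ᵗ f(s) db(s)` of a deterministic `C¹` function `f` against a Brownian
path `b`, defined pathwise by integration by parts (the Paley-Wiener-Zygmund integral; for a
continuous path it is the limit of the sums `∑ f(s_j) (b(s_{j+1}) - b(s_j))`). -/
def wienerIntegral (f : ℝ → ℝ) (b : ℝ≥0 → ℂ) (t : ℝ) : ℂ :=
  (f t : ℂ) * b t.toNNReal - (f 0 : ℂ) * b 0 - ∫ s in (0 : ℝ)..t, ((deriv f s : ℝ) : ℂ) * b s.toNNReal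

/-- The Fourier coefficient at `n`, `|n| ≤ N`, of
`z_N(t) = ∂_t𝒟_N(t) z_{0,N} + 𝒟_N(t) (z_{0,N} + z_{1,N}) + α_N ∫₀ᵗ 𝒟_N(t - s) P_N dW(s)`, where
`z_{0,N} = (α_N / √2) ∑_{|n| ≤ N} g_n / √(λ_N + |n|²) e_n`, `z_{1,N} = (α_N / √2) ∑_{|n| ≤ N} h_n e_n`
and `W = ∑ β_n e_n`; here `a = α_N`. -/
def zCoeff {Ω : Type*} (g h : Freq → Ω → ℂ) (β : Freq → ℝ≥0 → Ω → ℂ) (a : ℝ) (N : ℕ) (ω : Ω)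
    (t : ℝ) (n : Freq) : ℂ :=
  linearFlow (renorm a N) n
      (((a / √2 : ℝ) : ℂ) * (g n ω / ((√(renorm a N + freqSq n) : ℝ) : ℂ)))
      (((a / √2 : ℝ) : ℂ) * h n ω) t
    + (a : ℂ) * wienerIntegral (fun s => propSymbol (renorm a N) n (t - s)) (fun s => β n s ω) t

/-- The linear solution `z_N(t, x) = ∑_{|n| ≤ N} ẑ_N(t, n) e_n(x)`; the sum is real because
`ẑ_N(t, -n)` is the conjugate of `ẑ_N(t, n)`. -/
def zFn {Ω : Type*} (g h : Freq → Ω → ℂ) (β : Freq → ℝ≥0 → Ω → ℂ) (a : ℝ) (N : ℕ) (ω : Ω)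
    (t : ℝ) (x : Torus) : ℝ :=
  (∑ n ∈ freqBall N, zCoeff g h β a N ω t n * basisFn n x).re

/-- The Hermite polynomials `H_k(x; σ)`, with generating function
`exp (t x - σ t² / 2) = ∑ t^k / k! H_k(x; σ)`. -/
def hermiteVar : ℕ → ℝ → ℝ → ℝ
  | 0, _, _ => 1
  | 1, x, _ => x
  | k + 2, x, σ => x * hermiteVar (k + 1) x σ - (k + 1) * σ * hermiteVar k x σ

theorem hermiteVar_two (x σ : ℝ) : hermiteVar 2 x σ = x ^ 2 - σ := by
  simp [hermiteVar]; ring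

theorem hermiteVar_three (x σ : ℝ) : hermiteVar 3 x σ = x ^ 3 - 3 * σ * x := by
  simp [hermiteVar]; ring

/-- The Wick powers `:z_N^ℓ(t, x): = H_ℓ(z_N(t, x); σ_N)`. -/
def wickPow {Ω : Type*} (g h : Freq → Ω → ℂ) (β : Freq → ℝ≥0 → Ω → ℂ) (a : ℝ) (N : ℕ) (ω : Ω)
    (ℓ : ℕ) (t : ℝ) (x : Torus) : ℝ :=
  hermiteVar ℓ (zFn g h β a N ω t x) (wickVar a N)

/-! ### The residual equation -/

/-- The nonlinearity `v³ + 3 v² z_N + 3 v :z_N²: + :z_N³:` at time `t`. -/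
def forcing {Ω : Type*} (g h : Freq → Ω → ℂ) (β : Freq → ℝ≥0 → Ω → ℂ) (a : ℝ) (N : ℕ) (ω : Ω)
    (v : ℝ → L2) (t : ℝ) (x : Torus) : ℝ :=
  (v t x) ^ 3 + 3 * (v t x) ^ 2 * zFn g h β a N ω t x
    + 3 * v t x * wickPow g h β a N ω 2 t x + wickPow g h β a N ω 3 t x

/-- `v ∈ X¹(T)` solves, on `[0,T]`, the Cauchy problem
`(∂_t² - Δ + ∂_t + λ_N) v + v³ + 3 v² z_N + 3 v :z_N²: + :z_N³: = 0`, `(v, ∂_t v)(0) = (v₀, v₁)`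
in the Duhamel formulation
`v(t) = ∂_t𝒟_N(t) v₀ + 𝒟_N(t) (v₀ + v₁) - ∫₀ᵗ 𝒟_N(t - s) (v³ + 3 v² z_N + 3 v :z_N²: + :z_N³:)(s) ds`,
written for each Fourier coefficient. -/
structure IsSolution {Ω : Type*} (g h : Freq → Ω → ℂ) (β : Freq → ℝ≥0 → Ω → ℂ) (a : ℝ) (N : ℕ)
    (ω : Ω) (v₀ v₁ : L2) (T : ℝ) (v : ℝ → L2) : Prop where
  memX1 : MemX1 T v
  duhamel : ∀ t ∈ Icc 0 T, ∀ n : Freq,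
    coeff (v t) n = linearFlow (renorm a N) n (coeff v₀ n) (coeff v₁ n) t
      - ∫ s in (0 : ℝ)..t, (propSymbol (renorm a N) n (t - s) : ℂ)
          * coeff (forcing g h β a N ω v s) n

end TrivSNLW

end

noncomputable section

namespace TrivSNLW

/-! ### The Fourier basis of `L²(𝕋²)` -/

/-! For fixed `N` the function `z_N` is a trigonometric polynomial whose coefficients are continuous
in time once the Brownian paths are. Randomness therefore enters only through one null set, common
to all `N`, `T` and data; everything else is deterministic. Since `σ` is constant in space and time,
the nonlinearity is the single Wick cube `u³ - 3σu` with `u = v + z`.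

Existence: for `ψ = ⟨∇⟩v + i∂_t v` the equation reads `ψ' = -i⟨∇⟩ψ - if`, with `f = ∂_t v + (λ-1)v +
(v+z)³ - 3σ(v+z)`. Setting `ψ(t) = e^{-it⟨∇⟩}U(t)` turns it into an ODE for `U` in `ℓ²`. Its vector
field is locally Lipschitz, because `H¹ ⊂ L⁶` (`eLpNorm_six_trig_le`) makes the cube a map from `H¹`
to `L²`. With a radial cutoff the field is globally Lipschitz, so Picard–Lindelöf covers `[0,T]` at
once. The cutoff is never active if its radius is large: the energy `½‖ψ‖² + ¼∫v⁴` has rate of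
change `⟨∂_t v, v³ - f⟩`, the cubes cancel, and what remains is at most quadratic in `v`, hence
controlled by the energy (`exists_energy_rate_le`, `exists_evolves`). Variation of parameters at
each frequency then gives the Duhamel formula (`duhamel_of_hasDerivWithinAt`).

Uniqueness does not use the energy: `𝒟_N` gains one derivative and the Wick cube is Lipschitz from
bounded sets of `H¹` to `L²`, so Grönwall applies to the `H¹` distance of two solutions
(`eqOn_of_duhamel`). -/

/-- The monomial `e^{i n·x}` on the torus. -/
def mono (n : Freq) : C(Torus, ℂ) where
  toFun x := fourier (n 0) (x 0) * fourier (n 1) (x 1)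
  continuous_toFun := by fun_prop

theorem mono_apply (n : Freq) (x : Torus) :
    mono n x = fourier (n 0) (x 0) * fourier (n 1) (x 1) := rfl

theorem mono_neg (n : Freq) (x : Torus) : mono (-n) x = conj (mono n x) := by
  simp only [mono_apply, Pi.neg_apply, fourier_neg, map_mul]

theorem mono_add (m n : Freq) (x : Torus) : mono (m + n) x = mono m x * mono n x := by
  simp only [mono_apply, Pi.add_apply, fourier_add]; ring

theorem mono_zero : mono 0 = 1 := by
  ext x; simp [mono_apply]

theorem norm_mono_apply (n : Freq) (x : Torus) : ‖mono n x‖ = 1 := by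
  rw [mono_apply, norm_mul, fourier_apply, fourier_apply, Circle.norm_coe, Circle.norm_coe,
    one_mul]

/-- The star subalgebra of `C(𝕋², ℂ)` generated by the monomials. -/
def monoSubalgebra : StarSubalgebra ℂ C(Torus, ℂ) where
  toSubalgebra := Algebra.adjoin ℂ (range mono)
  star_mem' := by
    change Algebra.adjoin ℂ (range mono) ≤ star (Algebra.adjoin ℂ (range mono))
    refine Algebra.adjoin_le ?_
    rintro _ ⟨n, rfl⟩
    refine Algebra.subset_adjoin ⟨-n, ?_⟩
    ext1 x
    simp only [mono_neg, starRingEnd_apply, ContinuousMap.star_apply]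

theorem monoSubalgebra_coe :
    monoSubalgebra.toSubalgebra.toSubmodule = Submodule.span ℂ (range mono) := by
  apply Algebra.adjoin_eq_span_of_subset
  refine .trans (fun x ↦ Submonoid.closure_induction (fun _ ↦ id) ⟨0, mono_zero⟩ ?_)
    Submodule.subset_span
  rintro _ _ _ _ ⟨m, rfl⟩ ⟨n, rfl⟩
  exact ⟨m + n, by ext z; simp only [mono_add, ContinuousMap.mul_apply]⟩

/-- Two distinct points differ in some coordinate, and the first character of that coordinate is
injective on the circle. -/
theorem monoSubalgebra_separatesPoints : monoSubalgebra.SeparatesPoints := by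
  intro x y hxy
  have hinj : ∀ a b : AddCircle (2 * Real.pi), fourier 1 a = fourier 1 b → a = b := by
    intro a b hab
    rw [fourier_one, fourier_one, Circle.coe_inj] at hab
    exact AddCircle.injective_toCircle Real.two_pi_pos.ne' hab
  by_cases h0 : x 0 = y 0
  · have h1 : x 1 ≠ y 1 := fun h1 => hxy (by ext i; fin_cases i <;> assumption)
    refine ⟨mono ![0, 1], ⟨mono ![0, 1], Algebra.subset_adjoin ⟨_, rfl⟩, rfl⟩, fun h => h1 ?_⟩
    exact hinj _ _ (by simpa [mono_apply] using h)
  · refine ⟨mono ![1, 0], ⟨mono ![1, 0], Algebra.subset_adjoin ⟨_, rfl⟩, rfl⟩, fun h => h0 ?_⟩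
    exact hinj _ _ (by simpa [mono_apply] using h)

/-- Stone–Weierstrass: the span of the monomials is already a star algebra, since products and
conjugates of monomials are monomials. -/
theorem span_mono_closure_eq_top :
    (Submodule.span ℂ (range mono)).topologicalClosure = ⊤ := by
  rw [← monoSubalgebra_coe]
  exact congr_arg (Subalgebra.toSubmodule <| StarSubalgebra.toSubalgebra ·)
    (ContinuousMap.starSubalgebra_topologicalClosure_eq_top_of_separatesPoints _
      monoSubalgebra_separatesPoints)

/-- The basis function `e_n` as a continuous function. -/
def basisMap (n : Freq) : C(Torus, ℂ) := (((2 * Real.pi : ℝ) : ℂ)⁻¹) • mono n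

theorem continuous_basisFn (n : Freq) : Continuous (basisFn n) := (basisMap n).continuous

theorem basisFn_neg (n : Freq) (x : Torus) : basisFn (-n) x = conj (basisFn n x) := by
  change _ * mono (-n) x = conj (_ * mono n x)
  rw [mono_neg, map_mul, map_inv₀, Complex.conj_ofReal]

theorem norm_basisFn (n : Freq) (x : Torus) : ‖basisFn n x‖ = (2 * Real.pi)⁻¹ := by
  change ‖_ * mono n x‖ = _
  rw [norm_mul, norm_mono_apply, mul_one, norm_inv, Complex.norm_real, Real.norm_eq_abs,
    abs_of_pos Real.two_pi_pos]

theorem integral_fourier_circle (m : ℤ) :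
    ∫ x : AddCircle (2 * Real.pi), fourier m x = if m = 0 then ((2 * Real.pi : ℝ) : ℂ) else 0 := by
  have h := (orthonormal_iff_ite.mp (@orthonormal_fourier (2 * Real.pi) _)) 0 m
  simp only [ContinuousMap.inner_toLp, fourier_zero, map_one, mul_one] at h
  rw [AddCircle.integral_haarAddCircle] at h
  have hpi : (((2 * Real.pi : ℝ) : ℂ)) ≠ 0 := by
    exact_mod_cast Real.two_pi_pos.ne'
  rw [Complex.real_smul, Complex.ofReal_inv, inv_mul_eq_iff_eq_mul₀ hpi] at h
  rw [h]
  by_cases hm : m = 0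
  · rw [if_pos hm.symm, if_pos hm, mul_one]
  · rw [if_neg (Ne.symm hm), if_neg hm, mul_zero]

theorem integral_mono (m : Freq) :
    ∫ x : Torus, mono m x = if m = 0 then ((2 * Real.pi : ℝ) : ℂ) ^ 2 else 0 := by
  have h1 : (fun x : Torus => mono m x) = fun x => ∏ i : Fin 2, fourier (m i) (x i) := by
    ext x; simp [mono_apply, Fin.prod_univ_two]
  rw [h1, MeasureTheory.integral_fintype_prod_volume_eq_prod (fun i x => fourier (m i) x)]
  simp only [integral_fourier_circle, Fin.prod_univ_two]
  by_cases h : m = 0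
  · simp [h, sq]
  · have : m 0 ≠ 0 ∨ m 1 ≠ 0 := by
      by_contra! hc
      exact h (by ext i; fin_cases i <;> simp [hc])
    rcases this with h' | h' <;> simp [h, h']

/-- The basis function `e_n` as an element of `L²`. -/
abbrev basisLp (n : Freq) : Lp ℂ 2 (volume : Measure Torus) :=
  ContinuousMap.toLp (E := ℂ) 2 volume ℂ (basisMap n)

theorem orthonormal_basisLp : Orthonormal ℂ basisLp := by
  rw [orthonormal_iff_ite]
  intro m n
  have hpi : (((2 * Real.pi : ℝ) : ℂ)) ≠ 0 := by
    exact_mod_cast Real.two_pi_pos.ne'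
  simp only [basisLp, ContinuousMap.inner_toLp]
  have h : ∀ x, basisMap n x * conj (basisMap m x)
      = (((2 * Real.pi : ℝ) : ℂ)⁻¹) ^ 2 * mono (n + -m) x := by
    intro x
    rw [mono_add, mono_neg]
    change (_ * mono n x) * conj (_ * mono m x) = _
    rw [map_mul, map_inv₀, Complex.conj_ofReal]; ring
  simp only [h]
  rw [integral_const_mul, integral_mono]
  by_cases hmn : m = n
  · subst hmn
    simp only [add_neg_cancel, if_true]
    field_simp
  · have : n + -m ≠ 0 := by
      intro hc; exact hmn (by rw [← sub_eq_add_neg, sub_eq_zero] at hc; exact hc.symm)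
    simp [hmn, this]

/-- Uniform density in the continuous functions passes to `L²`, because the continuous functions
have dense image there. -/
theorem span_basisLp_closure_eq_top :
    (Submodule.span ℂ (range basisLp)).topologicalClosure = ⊤ := by
  have hpi : (((2 * Real.pi : ℝ) : ℂ)) ≠ 0 := by
    exact_mod_cast Real.two_pi_pos.ne'
  have h1 : (Submodule.span ℂ (range basisMap)).topologicalClosure = ⊤ := by
    rw [eq_top_iff, ← span_mono_closure_eq_top]
    refine Submodule.topologicalClosure_mono (Submodule.span_le.mpr ?_)
    rintro _ ⟨n, rfl⟩
    have : mono n = ((2 * Real.pi : ℝ) : ℂ) • basisMap n := by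
      rw [basisMap, smul_smul, mul_inv_cancel₀ hpi, one_smul]
    rw [this]
    exact Submodule.smul_mem _ _ (Submodule.subset_span ⟨n, rfl⟩)
  simpa only [Submodule.map_span, ContinuousLinearMap.coe_coe, ← range_comp,
    Function.comp_def] using
    (ContinuousMap.toLp_denseRange ℂ (volume : Measure Torus) ℂ
      (p := 2) (by simp)).topologicalClosure_map_submodule h1

/-- The Fourier basis of `L²(𝕋²; ℂ)`. -/
def torusBasis : HilbertBasis Freq ℂ (Lp ℂ 2 (volume : Measure Torus)) :=
  HilbertBasis.mk orthonormal_basisLp span_basisLp_closure_eq_top.ge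

theorem coe_torusBasis : ⇑torusBasis = basisLp := HilbertBasis.coe_mk _ _

theorem coeFn_torusBasis (n : Freq) : torusBasis n =ᵐ[volume] basisFn n := by
  rw [coe_torusBasis]
  exact ContinuousMap.coeFn_toLp (𝕜 := ℂ) volume (basisMap n)

theorem torusBasis_repr (f : Lp ℂ 2 (volume : Measure Torus)) (n : Freq) :
    torusBasis.repr f n = ∫ x, f x * conj (basisFn n x) := by
  rw [torusBasis.repr_apply_apply, MeasureTheory.L2.inner_def]
  refine integral_congr_ae ?_
  filter_upwards [coeFn_torusBasis n] with x hx
  rw [hx, RCLike.inner_apply]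

/-! ### The Fourier transform between real functions and sequences -/

/-- The Hilbert space `ℓ²(ℤ²; ℂ)`. -/
abbrev Seq : Type := lp (fun _ : Freq => ℂ) 2

/-- The real-linear inclusion of the real-valued functions into `L²(𝕋²; ℂ)`. -/
def ofRealL2 : L2 →L[ℝ] Lp ℂ 2 (volume : Measure Torus) := Complex.ofRealCLM.compLpL 2 volume

/-- The real part on `L²(𝕋²; ℂ)`. -/
def reL2 : Lp ℂ 2 (volume : Measure Torus) →L[ℝ] L2 := Complex.reCLM.compLpL 2 volume

theorem coeFn_ofRealL2 (f : L2) : ofRealL2 f =ᵐ[volume] fun x => (f x : ℂ) :=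
  ContinuousLinearMap.coeFn_compLp _ _

theorem coeFn_reL2 (f : Lp ℂ 2 (volume : Measure Torus)) :
    reL2 f =ᵐ[volume] fun x => (f x).re :=
  ContinuousLinearMap.coeFn_compLp _ _

theorem norm_ofRealL2 (f : L2) : ‖ofRealL2 f‖ = ‖f‖ := by
  rw [Lp.norm_def, Lp.norm_def]
  congr 1
  refine eLpNorm_congr_norm_ae ?_
  filter_upwards [coeFn_ofRealL2 f] with x hx
  rw [hx, Complex.norm_real]

theorem norm_reL2_le (f : Lp ℂ 2 (volume : Measure Torus)) : ‖reL2 f‖ ≤ ‖f‖ := by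
  refine Lp.norm_le_norm_of_ae_le ?_
  filter_upwards [coeFn_reL2 f] with x hx
  rw [hx]
  exact Complex.abs_re_le_norm _

theorem reL2_ofRealL2 (f : L2) : reL2 (ofRealL2 f) = f := by
  refine Lp.ext ?_
  filter_upwards [coeFn_reL2 (ofRealL2 f), coeFn_ofRealL2 f] with x h1 h2
  rw [h1, h2, Complex.ofReal_re]

theorem Seq_coe_smul (r : ℝ) (c : Seq) : (r : ℂ) • c = r • c := by
  ext n
  rw [lp.coeFn_smul, lp.coeFn_smul, Pi.smul_apply, Pi.smul_apply, Complex.coe_smul]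

theorem Lp_coe_smul (r : ℝ) (f : Lp ℂ 2 (volume : Measure Torus)) : (r : ℂ) • f = r • f := by
  refine Lp.ext ?_
  filter_upwards [Lp.coeFn_smul (r : ℂ) f, Lp.coeFn_smul r f] with x h1 h2
  rw [h1, h2, Pi.smul_apply, Pi.smul_apply, Complex.coe_smul]

/-- The Fourier coefficients of a real-valued function, as an isometry into `ℓ²`. -/
def fourierSeq : L2 →ₗᵢ[ℝ] Seq where
  toFun f := torusBasis.repr (ofRealL2 f)
  map_add' f g := by rw [map_add, map_add]
  map_smul' c f := by
    rw [map_smul, ← Lp_coe_smul, map_smul, RingHom.id_apply, Seq_coe_smul]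
  norm_map' f := by
    change ‖torusBasis.repr (ofRealL2 f)‖ = _
    rw [LinearIsometryEquiv.norm_map, norm_ofRealL2]

/-- The real part of the function with the given Fourier coefficients. -/
def synth : Seq →L[ℝ] L2 :=
  LinearMap.mkContinuous
    { toFun := fun c => reL2 (torusBasis.repr.symm c)
      map_add' := fun c d => by rw [map_add, map_add]
      map_smul' := fun r c => by
        rw [← Seq_coe_smul, map_smul, Lp_coe_smul, map_smul, RingHom.id_apply] } 1
    (fun c => (norm_reL2_le (torusBasis.repr.symm c)).trans
      (((LinearIsometryEquiv.norm_map torusBasis.repr.symm c).le).trans (one_mul ‖c‖).ge))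

theorem synth_apply (c : Seq) : synth c = reL2 (torusBasis.repr.symm c) := rfl

theorem norm_synth_le (c : Seq) : ‖synth c‖ ≤ ‖c‖ :=
  (norm_reL2_le _).trans (LinearIsometryEquiv.norm_map _ _).le

theorem fourierSeq_apply (f : L2) (n : Freq) : fourierSeq f n = coeff f n := by
  change torusBasis.repr (ofRealL2 f) n = _
  rw [torusBasis_repr]
  refine integral_congr_ae ?_
  filter_upwards [coeFn_ofRealL2 f] with x hx
  rw [hx]

theorem synth_fourierSeq (f : L2) : synth (fourierSeq f) = f := by
  rw [synth_apply]
  change reL2 (torusBasis.repr.symm (torusBasis.repr (ofRealL2 f))) = f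
  rw [LinearIsometryEquiv.symm_apply_apply, reL2_ofRealL2]

theorem coeff_congr {f g : Torus → ℝ} (h : f =ᵐ[volume] g) (n : Freq) : coeff f n = coeff g n := by
  refine integral_congr_ae ?_
  filter_upwards [h] with x hx
  rw [hx]

theorem coeff_neg (f : Torus → ℝ) (n : Freq) : coeff f (-n) = conj (coeff f n) := by
  rw [coeff, coeff, ← integral_conj]
  refine integral_congr_ae (.of_forall fun x => ?_)
  simp [basisFn_neg]

theorem L2_ext_coeff {f g : L2} (h : ∀ n, coeff f n = coeff g n) : f = g := by
  refine fourierSeq.injective ?_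
  ext n
  rw [fourierSeq_apply, fourierSeq_apply, h]

/-- Sequences carry no reality constraint, so taking the real part symmetrises them. Hence `synth`
is a left inverse of `fourierSeq` but not a right inverse. -/
theorem coeff_synth (c : Seq) (n : Freq) : coeff (synth c) n = (c n + conj (c (-n))) / 2 := by
  set f := torusBasis.repr.symm c with hf
  have hc : ∀ m, c m = ∫ x, f x * conj (basisFn m x) := by
    intro m
    rw [← torusBasis_repr, hf, LinearIsometryEquiv.apply_symm_apply]
  have hbd : ∀ m, MemLp (fun x => conj (basisFn m x)) 2 (volume : Measure Torus) := fun m =>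
    ((Complex.continuous_conj.comp (continuous_basisFn m))).memLp_of_hasCompactSupport
      (HasCompactSupport.of_compactSpace _)
  have hint : ∀ m, Integrable (fun x => f x * conj (basisFn m x)) := fun m =>
    (Lp.memLp f).integrable_mul (hbd m)
  have h2 : conj (c (-n)) = ∫ x, conj (f x) * conj (basisFn n x) := by
    rw [hc, ← integral_conj]
    refine integral_congr_ae (.of_forall fun x => ?_)
    simp [basisFn_neg]
  have hint2 : Integrable (fun x => conj (f x) * conj (basisFn n x)) := by
    have := (hint (-n))
    have h3 := (Complex.conjCLE.toContinuousLinearMap.integrable_comp this)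
    refine h3.congr (.of_forall fun x => ?_)
    simp [basisFn_neg]
  rw [h2, hc n, ← integral_add (hint n) hint2, ← integral_div]
  refine integral_congr_ae ?_
  filter_upwards [coeFn_reL2 f] with x hx
  rw [synth_apply, hx, Complex.re_eq_add_conj]
  ring

/-- `synth` is the adjoint of `fourierSeq`: Parseval, and pairing with a real function sees only the
real part. The energy identity needs this to move from sequences to functions. -/
theorem inner_fourierSeq (c : Seq) (f : L2) : inner ℝ c (fourierSeq f) = inner ℝ (synth c) f := by
  set F := torusBasis.repr.symm c with hF
  have hc : c = torusBasis.repr F := by rw [hF, LinearIsometryEquiv.apply_symm_apply]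
  have h1 : inner ℝ c (fourierSeq f) = (inner ℂ c (fourierSeq f) : ℂ).re := by
    have := (Complex.reCLM.hasSum (lp.hasSum_inner (𝕜 := ℂ) c (fourierSeq f)))
    have h2 := lp.hasSum_inner (𝕜 := ℝ) c (fourierSeq f)
    have e : (fun n => Complex.reCLM (inner ℂ (c n) (fourierSeq f n)))
        = fun n => inner ℝ (c n) (fourierSeq f n) := by
      ext n
      simp
    rw [e] at this
    exact h2.unique this
  rw [h1, hc]
  change (inner ℂ (torusBasis.repr F) (torusBasis.repr (ofRealL2 f))).re = _
  rw [LinearIsometryEquiv.inner_map_map, MeasureTheory.L2.inner_def, MeasureTheory.L2.inner_def,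
    ← hc, synth_apply, ← hF]
  rw [← Complex.reCLM_apply, ← ContinuousLinearMap.integral_comp_comm _ (L2.integrable_inner _ _)]
  refine integral_congr_ae ?_
  filter_upwards [coeFn_reL2 F, coeFn_ofRealL2 f] with x h3 h4
  rw [h3, h4]
  simp

/-! ### Square-summable sequences and multipliers -/

theorem seq_hasSum_sq (c : Seq) : HasSum (fun n => ‖c n‖ ^ 2) (‖c‖ ^ 2) := by
  have h := lp.hasSum_norm (p := 2) (by simp) c
  simpa using h

theorem memℓp_two_of_summable {f : Freq → ℂ} (h : Summable fun n => ‖f n‖ ^ 2) : Memℓp f 2 :=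
  memℓp_gen (by simpa using h)

theorem seq_norm_le_of_forall {c d : Seq} {C : ℝ} (hC : 0 ≤ C) (h : ∀ n, ‖c n‖ ≤ C * ‖d n‖) :
    ‖c‖ ≤ C * ‖d‖ := by
  refine (sq_le_sq₀ (norm_nonneg _) (by positivity)).mp ?_
  rw [mul_pow]
  refine hasSum_le (fun n => ?_) (seq_hasSum_sq c) ((seq_hasSum_sq d).mul_left (C ^ 2))
  rw [← mul_pow]
  exact pow_le_pow_left₀ (norm_nonneg _) (h n) 2

/-- The multiplication of a sequence by a bounded symbol. -/
def mult (m : Freq → ℂ) (h : ∃ C : ℝ, ∀ n, ‖m n‖ ≤ C) : Seq →L[ℝ] Seq :=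
  LinearMap.mkContinuousOfExistsBound
    { toFun := fun c => ⟨fun n => m n * c n, by
        obtain ⟨C, hC⟩ := h
        refine memℓp_two_of_summable
          (Summable.of_nonneg_of_le (fun n => by positivity) (fun n => ?_)
            ((seq_hasSum_sq c).summable.mul_left (C ^ 2)))
        rw [norm_mul, mul_pow]
        exact mul_le_mul_of_nonneg_right (pow_le_pow_left₀ (norm_nonneg _) (hC n) 2)
          (by positivity)⟩
      map_add' := fun c d => by
        ext n
        change m n * (c n + d n) = m n * c n + m n * d n
        ring
      map_smul' := fun r c => by
        ext n
        change m n * (r • c n) = r • (m n * c n)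
        rw [Complex.real_smul, Complex.real_smul]; ring }
    (by
      obtain ⟨C, hC⟩ := h
      refine ⟨C, fun c => seq_norm_le_of_forall ((norm_nonneg _).trans (hC 0)) fun n => ?_⟩
      change ‖m n * c n‖ ≤ _
      rw [norm_mul]
      exact mul_le_mul_of_nonneg_right (hC n) (norm_nonneg _))

theorem mult_apply (m : Freq → ℂ) (h : ∃ C : ℝ, ∀ n, ‖m n‖ ≤ C) (c : Seq) (n : Freq) :
    mult m h c n = m n * c n := rfl

theorem norm_mult_le {m : Freq → ℂ} {C : ℝ} (hC : ∀ n, ‖m n‖ ≤ C) (c : Seq) :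
    ‖mult m ⟨C, hC⟩ c‖ ≤ C * ‖c‖ := by
  refine seq_norm_le_of_forall ((norm_nonneg _).trans (hC 0)) fun n => ?_
  rw [mult_apply, norm_mul]
  exact mul_le_mul_of_nonneg_right (hC n) (norm_nonneg _)

/-- Strong continuity of multipliers with uniformly bounded symbols. -/
theorem tendsto_mult {ι : Type*} {l : Filter ι} [l.IsCountablyGenerated]
    {m : ι → Freq → ℂ} {m₀ : Freq → ℂ} {C : ℝ}
    (hm : ∀ i n, ‖m i n‖ ≤ C) (hm₀ : ∀ n, ‖m₀ n‖ ≤ C)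
    (hpt : ∀ n, Tendsto (fun i => m i n) l (𝓝 (m₀ n))) {c : ι → Seq} {c₀ : Seq}
    (hc : Tendsto c l (𝓝 c₀)) :
    Tendsto (fun i => mult (m i) ⟨C, hm i⟩ (c i)) l (𝓝 (mult m₀ ⟨C, hm₀⟩ c₀)) := by
  have hC : 0 ≤ C := (norm_nonneg _).trans (hm₀ 0)
  rw [tendsto_iff_norm_sub_tendsto_zero]
  have h1 : Tendsto (fun i => C * ‖c i - c₀‖) l (𝓝 0) := by
    have := (tendsto_iff_norm_sub_tendsto_zero.mp hc).const_mul C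
    simpa using this
  -- Against the fixed sequence `c₀`, pointwise convergence of the symbols is enough by dominated
  -- convergence; the moving part `c i - c₀` is absorbed by the uniform bound `C`.
  have h2 : Tendsto (fun i => ‖mult (m i) ⟨C, hm i⟩ c₀ - mult m₀ ⟨C, hm₀⟩ c₀‖ ^ 2) l (𝓝 0) := by
    have hsum : ∀ i, ‖mult (m i) ⟨C, hm i⟩ c₀ - mult m₀ ⟨C, hm₀⟩ c₀‖ ^ 2
        = ∑' n, ‖(m i n - m₀ n) * c₀ n‖ ^ 2 := by
      intro i
      rw [← (seq_hasSum_sq _).tsum_eq]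
      refine tsum_congr fun n => ?_
      rw [lp.coeFn_sub, Pi.sub_apply, mult_apply, mult_apply, sub_mul]
    simp only [hsum]
    have h0 : (0 : ℝ) = ∑' n : Freq, (0 : ℝ) := by simp
    rw [h0]
    refine tendsto_tsum_of_dominated_convergence (bound := fun n => (2 * C) ^ 2 * ‖c₀ n‖ ^ 2)
      ((seq_hasSum_sq c₀).summable.mul_left _) (fun n => ?_) (.of_forall fun i n => ?_)
    · have h3 : Tendsto (fun i => ‖(m i n - m₀ n) * c₀ n‖ ^ 2) l
          (𝓝 (‖(m₀ n - m₀ n) * c₀ n‖ ^ 2)) :=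
        ((((hpt n).sub_const _).mul_const _).norm).pow 2
      simpa using h3
    · rw [Real.norm_eq_abs, abs_of_nonneg (by positivity), norm_mul, mul_pow]
      refine mul_le_mul_of_nonneg_right (pow_le_pow_left₀ (norm_nonneg _) ?_ 2) (by positivity)
      calc ‖m i n - m₀ n‖ ≤ ‖m i n‖ + ‖m₀ n‖ := norm_sub_le _ _
        _ ≤ 2 * C := by linarith [hm i n, hm₀ n]
  have h3 : Tendsto (fun i => ‖mult (m i) ⟨C, hm i⟩ c₀ - mult m₀ ⟨C, hm₀⟩ c₀‖) l (𝓝 0) := by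
    have := h2.sqrt
    simpa using this
  refine squeeze_zero (fun _ => norm_nonneg _) (fun i => ?_) (by simpa using h1.add h3)
  have e : mult (m i) ⟨C, hm i⟩ (c i) - mult m₀ ⟨C, hm₀⟩ c₀
      = mult (m i) ⟨C, hm i⟩ (c i - c₀) + (mult (m i) ⟨C, hm i⟩ c₀ - mult m₀ ⟨C, hm₀⟩ c₀) := by
    rw [map_sub]; abel
  rw [e]
  exact (norm_add_le _ _).trans (by gcongr; exact norm_mult_le (hm i) _)

/-! ### The Japanese bracket and the Sobolev embedding `H¹ ⊂ L⁶` -/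

/-- The Japanese bracket `⟨n⟩ = (1 + |n|²)^{1/2}`. -/
def jb (n : Freq) : ℝ := √(1 + freqSq n)

theorem jb_sq (n : Freq) : jb n ^ 2 = 1 + freqSq n :=
  Real.sq_sqrt (by linarith [freqSq_nonneg n])

theorem one_le_jb (n : Freq) : 1 ≤ jb n :=
  Real.one_le_sqrt.mpr (by linarith [freqSq_nonneg n])

theorem jb_pos (n : Freq) : 0 < jb n := one_pos.trans_le (one_le_jb n)

theorem freqSq_neg (n : Freq) : freqSq (-n) = freqSq n := by simp [freqSq]

theorem jb_neg (n : Freq) : jb (-n) = jb n := by rw [jb, jb, freqSq_neg]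

theorem norm_le_jb (n : Freq) : ‖n‖ ≤ jb n := by
  refine (pi_norm_le_iff_of_nonneg (jb_pos n).le).mpr fun i => ?_
  refine Real.le_sqrt_of_sq_le ?_
  rw [Int.norm_eq_abs, sq_abs, freqSq]
  fin_cases i <;> simp <;> nlinarith [sq_nonneg (n 0 : ℝ), sq_nonneg (n 1 : ℝ)]

/-- The exponent 3 exceeds the dimension 2; the comparison is with the lattice sum used for
Eisenstein series. -/
theorem summable_jb : Summable fun n : Freq => (jb n)⁻¹ ^ 3 := by
  have h := EisensteinSeries.summable_one_div_norm_rpow (k := 3) (by norm_num)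
  refine Summable.of_norm_bounded_eventually h ?_
  filter_upwards [(Set.finite_singleton (0 : Freq)).compl_mem_cofinite] with n hn
  have hn0 : 0 < ‖n‖ := norm_pos_iff.mpr (by simpa using hn)
  have hj := jb_pos n
  rw [Real.norm_eq_abs, abs_of_nonneg (by positivity), Real.rpow_neg hn0.le,
    show (3 : ℝ) = ((3 : ℕ) : ℝ) by norm_num, Real.rpow_natCast, ← inv_pow]
  exact pow_le_pow_left₀ (by positivity) (inv_anti₀ hn0 (norm_le_jb n)) 3

/-- The constant `∑ ⟨n⟩⁻³`. -/
def jbSum : ℝ := ∑' n : Freq, (jb n)⁻¹ ^ 3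

theorem jbSum_nonneg : 0 ≤ jbSum :=
  tsum_nonneg fun n => pow_nonneg (inv_nonneg.mpr (jb_pos n).le) 3

/-- AM–GM on the pairwise products, as `(xyz)² = (xy)(yz)(xz)`. Each term on the right involves only
two variables, with the summable power 3. -/
theorem jb_prod_le {x y z : ℝ} (hx : 0 ≤ x) (hy : 0 ≤ y) (hz : 0 ≤ z) :
    (x * y * z) ^ 2 ≤ (x * y) ^ 3 + (y * z) ^ 3 + (x * z) ^ 3 := by
  have ha : 0 ≤ x * y := by positivity
  have hb : 0 ≤ y * z := by positivity
  have hc : 0 ≤ x * z := by positivity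
  have e : (x * y * z) ^ 2 = (x * y) * (y * z) * (x * z) := by ring
  rw [e]
  generalize x * y = a at *
  generalize y * z = b at *
  generalize x * z = c at *
  have h1 : 3 * (a * b * c) ≤ a ^ 3 + b ^ 3 + c ^ 3 := by
    nlinarith [mul_nonneg (add_nonneg (add_nonneg ha hb) hc)
      (add_nonneg (add_nonneg (sq_nonneg (a - b)) (sq_nonneg (b - c))) (sq_nonneg (a - c)))]
  have h2 : 0 ≤ a * b * c := by positivity
  linarith

theorem sum_jb_pair_le (s : Finset (Freq × Freq)) :
    ∑ p ∈ s, ((jb p.1)⁻¹ * (jb p.2)⁻¹) ^ 3 ≤ jbSum ^ 2 := by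
  have hnn : ∀ n : Freq, 0 ≤ (jb n)⁻¹ ^ 3 := fun n => pow_nonneg (inv_nonneg.mpr (jb_pos n).le) 3
  calc ∑ p ∈ s, ((jb p.1)⁻¹ * (jb p.2)⁻¹) ^ 3
      ≤ ∑ p ∈ s.image Prod.fst ×ˢ s.image Prod.snd, ((jb p.1)⁻¹ * (jb p.2)⁻¹) ^ 3 := by
        refine Finset.sum_le_sum_of_subset_of_nonneg Finset.subset_product fun p _ _ => ?_
        rw [mul_pow]
        exact mul_nonneg (hnn _) (hnn _)
    _ = (∑ n ∈ s.image Prod.fst, (jb n)⁻¹ ^ 3) * ∑ n ∈ s.image Prod.snd, (jb n)⁻¹ ^ 3 := by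
        rw [Finset.sum_product, Finset.sum_mul_sum]
        simp only [mul_pow]
    _ ≤ jbSum * jbSum :=
        mul_le_mul (summable_jb.sum_le_tsum _ fun n _ => hnn n)
          (summable_jb.sum_le_tsum _ fun n _ => hnn n) (Finset.sum_nonneg fun n _ => hnn n)
          jbSum_nonneg
    _ = jbSum ^ 2 := by ring

/-- The weights `⟨n₁⟩⁻² ⟨n₂⟩⁻² ⟨n₃⟩⁻²` are summable over `n₁ + n₂ + n₃ = m`, uniformly in `m`. -/
theorem sum_jb_triple_le (s : Finset (Freq × Freq × Freq)) (m : Freq)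
    (hs : ∀ t ∈ s, t.1 + t.2.1 + t.2.2 = m) :
    ∑ t ∈ s, ((jb t.1)⁻¹ * (jb t.2.1)⁻¹ * (jb t.2.2)⁻¹) ^ 2 ≤ 3 * jbSum ^ 2 := by
  have hj : ∀ n : Freq, 0 ≤ (jb n)⁻¹ := fun n => inv_nonneg.mpr (jb_pos n).le
  -- On `n₁ + n₂ + n₃ = m` any two frequencies determine the third, so each projection to a pair is
  -- injective and the bound no longer depends on `m`.
  have key : ∀ φ : Freq × Freq × Freq → Freq × Freq, Set.InjOn φ s →
      ∑ t ∈ s, ((jb (φ t).1)⁻¹ * (jb (φ t).2)⁻¹) ^ 3 ≤ jbSum ^ 2 := by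
    intro φ hφ
    rw [← Finset.sum_image (f := fun p : Freq × Freq => ((jb p.1)⁻¹ * (jb p.2)⁻¹) ^ 3) hφ]
    exact sum_jb_pair_le _
  have h1 := key (fun t => (t.1, t.2.1)) (by
    rintro ⟨a, b, c⟩ h ⟨a', b', c'⟩ h' he
    have e1 := hs _ h
    have e2 := hs _ h'
    simp only [Prod.mk.injEq] at he e1 e2 ⊢
    obtain ⟨rfl, rfl⟩ := he
    exact ⟨rfl, rfl, add_left_cancel (e1.trans e2.symm)⟩)
  have h2 := key (fun t => (t.2.1, t.2.2)) (by
    rintro ⟨a, b, c⟩ h ⟨a', b', c'⟩ h' he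
    have e1 := hs _ h
    have e2 := hs _ h'
    simp only [Prod.mk.injEq] at he e1 e2 ⊢
    obtain ⟨rfl, rfl⟩ := he
    exact ⟨add_right_cancel (add_right_cancel (e1.trans e2.symm)), rfl, rfl⟩)
  have h3 := key (fun t => (t.1, t.2.2)) (by
    rintro ⟨a, b, c⟩ h ⟨a', b', c'⟩ h' he
    have e1 := hs _ h
    have e2 := hs _ h'
    simp only [Prod.mk.injEq] at he e1 e2 ⊢
    obtain ⟨rfl, rfl⟩ := he
    exact ⟨rfl, add_left_cancel (add_right_cancel (e1.trans e2.symm)), rfl⟩)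
  calc ∑ t ∈ s, ((jb t.1)⁻¹ * (jb t.2.1)⁻¹ * (jb t.2.2)⁻¹) ^ 2
      ≤ ∑ t ∈ s, (((jb t.1)⁻¹ * (jb t.2.1)⁻¹) ^ 3 + ((jb t.2.1)⁻¹ * (jb t.2.2)⁻¹) ^ 3
          + ((jb t.1)⁻¹ * (jb t.2.2)⁻¹) ^ 3) :=
        Finset.sum_le_sum fun t _ => jb_prod_le (hj _) (hj _) (hj _)
    _ ≤ 3 * jbSum ^ 2 := by
        rw [Finset.sum_add_distrib, Finset.sum_add_distrib]
        simp only at h1 h2 h3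
        linarith

/-- The `L²` norm of a trigonometric sum with repeated frequencies. -/
theorem norm_sq_sum_basis {ι : Type*} (s : Finset ι) (A : ι → ℂ) (σ : ι → Freq) :
    ‖∑ t ∈ s, A t • torusBasis (σ t)‖ ^ 2
      = ∑ m ∈ s.image σ, ‖∑ t ∈ s with σ t = m, A t‖ ^ 2 := by
  have h1 : ∑ t ∈ s, A t • torusBasis (σ t)
      = ∑ m ∈ s.image σ, (∑ t ∈ s with σ t = m, A t) • torusBasis m := by
    rw [← Finset.sum_fiberwise_of_maps_to (g := σ) (t := s.image σ)
      (fun t ht => Finset.mem_image_of_mem σ ht)]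
    refine Finset.sum_congr rfl fun m _ => ?_
    rw [Finset.sum_smul]
    refine Finset.sum_congr rfl fun t ht => ?_
    rw [(Finset.mem_filter.mp ht).2]
  have h2 := torusBasis.orthonormal.inner_sum (fun m => ∑ t ∈ s with σ t = m, A t)
    (fun m => ∑ t ∈ s with σ t = m, A t) (s.image σ)
  rw [← h1] at h2
  rw [inner_self_eq_norm_sq_to_K] at h2
  have h3 : ((‖∑ t ∈ s, A t • torusBasis (σ t)‖ ^ 2 : ℝ) : ℂ)
      = ((∑ m ∈ s.image σ, ‖∑ t ∈ s with σ t = m, A t‖ ^ 2 : ℝ) : ℂ) := by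
    push_cast
    rw [show ((‖∑ t ∈ s, A t • torusBasis (σ t)‖ : ℝ) : ℂ) ^ 2
      = ((‖∑ t ∈ s, A t • torusBasis (σ t)‖ : ℝ) : ℂ) ^ 2 from rfl]
    refine h2.trans (Finset.sum_congr rfl fun m _ => ?_)
    exact RCLike.conj_mul _
  exact_mod_cast h3

/-- Grouping by the output frequency `m` and applying Cauchy–Schwarz on each fibre separates the
weights, whose sum is bounded uniformly in `m`, from the coefficients, whose total is the cube of
the `ℓ²` norm squared. -/
theorem norm_cubic_sum_le (S : Finset Freq) (c : Freq → ℂ) :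
    ‖∑ t ∈ S ×ˢ S ×ˢ S, (c t.1 * c t.2.1 * c t.2.2 *
        (((jb t.1)⁻¹ * (jb t.2.1)⁻¹ * (jb t.2.2)⁻¹ : ℝ) : ℂ)) •
          torusBasis (t.1 + t.2.1 + t.2.2)‖ ^ 2
      ≤ 3 * jbSum ^ 2 * (∑ n ∈ S, ‖c n‖ ^ 2) ^ 3 := by
  rw [norm_sq_sum_basis _ _ (fun t : Freq × Freq × Freq => t.1 + t.2.1 + t.2.2)]
  set I := S ×ˢ S ×ˢ S
  set σ : Freq × Freq × Freq → Freq := fun t => t.1 + t.2.1 + t.2.2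
  have h1 : ∀ m, ‖∑ t ∈ I with σ t = m, (c t.1 * c t.2.1 * c t.2.2 *
      (((jb t.1)⁻¹ * (jb t.2.1)⁻¹ * (jb t.2.2)⁻¹ : ℝ) : ℂ))‖ ^ 2
      ≤ 3 * jbSum ^ 2 * ∑ t ∈ I with σ t = m, ‖c t.1 * c t.2.1 * c t.2.2‖ ^ 2 := by
    intro m
    have hcs := Finset.sum_mul_sq_le_sq_mul_sq (I.filter fun t => σ t = m)
      (fun t => ‖c t.1 * c t.2.1 * c t.2.2‖)
      (fun t => (jb t.1)⁻¹ * (jb t.2.1)⁻¹ * (jb t.2.2)⁻¹)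
    have hw := sum_jb_triple_le (I.filter fun t => σ t = m) m
      (fun t ht => (Finset.mem_filter.mp ht).2)
    have hnorm : ‖∑ t ∈ I with σ t = m, (c t.1 * c t.2.1 * c t.2.2 *
        (((jb t.1)⁻¹ * (jb t.2.1)⁻¹ * (jb t.2.2)⁻¹ : ℝ) : ℂ))‖
        ≤ ∑ t ∈ I with σ t = m, ‖c t.1 * c t.2.1 * c t.2.2‖ *
          ((jb t.1)⁻¹ * (jb t.2.1)⁻¹ * (jb t.2.2)⁻¹) := by
      refine (norm_sum_le _ _).trans (Finset.sum_le_sum fun t _ => ?_)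
      have := jb_pos t.1
      have := jb_pos t.2.1
      have := jb_pos t.2.2
      rw [norm_mul _ (((_ : ℝ) : ℂ)), Complex.norm_real, Real.norm_eq_abs,
        abs_of_nonneg (by positivity)]
    calc _ ≤ _ := pow_le_pow_left₀ (norm_nonneg _) hnorm 2
      _ ≤ _ := hcs
      _ ≤ (∑ t ∈ I with σ t = m, ‖c t.1 * c t.2.1 * c t.2.2‖ ^ 2) * (3 * jbSum ^ 2) :=
          mul_le_mul_of_nonneg_left hw (Finset.sum_nonneg fun _ _ => by positivity)
      _ = _ := mul_comm _ _
  refine (Finset.sum_le_sum fun m _ => h1 m).trans (le_of_eq ?_)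
  rw [← Finset.mul_sum, Finset.sum_fiberwise_of_maps_to
    (fun t ht => Finset.mem_image_of_mem σ ht)]
  congr 1
  simp only [norm_mul, mul_pow, I, Finset.sum_product, ← Finset.mul_sum, ← Finset.sum_mul]
  ring

/-- The finite sums `∑_{n ∈ S} c_n ⟨n⟩⁻¹ e_n` are bounded in `L⁶` by the `ℓ²` norm of `c`. -/
theorem eLpNorm_six_trig_le (S : Finset Freq) (c : Freq → ℂ) {M : ℝ} (hM : 0 ≤ M)
    (hc : ∑ n ∈ S, ‖c n‖ ^ 2 ≤ M ^ 2) :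
    eLpNorm (∑ n ∈ S, (c n * (((jb n)⁻¹ : ℝ) : ℂ)) • torusBasis n :
        Lp ℂ 2 (volume : Measure Torus)) 6 volume
      ≤ ENNReal.ofReal ((1 + 3 * jbSum ^ 2) * M) := by
  set f : Lp ℂ 2 (volume : Measure Torus) :=
    ∑ n ∈ S, (c n * (((jb n)⁻¹ : ℝ) : ℂ)) • torusBasis n with hf
  set F : Lp ℂ 2 (volume : Measure Torus) :=
    ∑ t ∈ S ×ˢ S ×ˢ S, (c t.1 * c t.2.1 * c t.2.2 *
        (((jb t.1)⁻¹ * (jb t.2.1)⁻¹ * (jb t.2.2)⁻¹ : ℝ) : ℂ)) •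
          torusBasis (t.1 + t.2.1 + t.2.2) with hF
  have hcoe : ∀ {ι : Type} (s : Finset ι) (A : ι → ℂ) (σ : ι → Freq),
      (∑ t ∈ s, A t • torusBasis (σ t) : Lp ℂ 2 (volume : Measure Torus))
        =ᵐ[volume] fun x => ∑ t ∈ s, A t * basisFn (σ t) x := by
    intro ι s A σ
    have h1 : ∀ᵐ x ∂(volume : Measure Torus), ∀ n, torusBasis n x = basisFn n x :=
      ae_all_iff.mpr fun n => coeFn_torusBasis n
    have h2 : ∀ᵐ x ∂(volume : Measure Torus), ∀ t ∈ s, (A t • torusBasis (σ t) :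
        Lp ℂ 2 (volume : Measure Torus)) x = A t * torusBasis (σ t) x :=
      (ae_ball_iff s.countable_toSet).mpr fun t _ => by
        filter_upwards [Lp.coeFn_smul (A t) (torusBasis (σ t))] with x hx
        rw [hx]; rfl
    filter_upwards [h1, h2, Lp.coeFn_finsetSum s fun t => A t • torusBasis (σ t)] with x e1 e2 e3
    rw [e3, Finset.sum_apply]
    refine Finset.sum_congr rfl fun t ht => ?_
    rw [e2 t ht, e1]
  have hae : ∀ᵐ x ∂(volume : Measure Torus), ‖f x‖ ^ (3 : ℝ) ≤ ‖F x‖ := by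
    filter_upwards [hcoe S (fun n => c n * (((jb n)⁻¹ : ℝ) : ℂ)) id,
      hcoe (S ×ˢ S ×ˢ S) (fun t => c t.1 * c t.2.1 * c t.2.2 *
        (((jb t.1)⁻¹ * (jb t.2.1)⁻¹ * (jb t.2.2)⁻¹ : ℝ) : ℂ))
        (fun t => t.1 + t.2.1 + t.2.2)] with x e1 e2
    -- A product of three basis functions is `(2π)⁻²` times one basis function, so `f³` is the
    -- triple sum `F` up to a factor at most 1.
    have h1 : f x ^ 3 = (((2 * Real.pi : ℝ) : ℂ)⁻¹) ^ 2 * F x := by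
      rw [hf, hF]
      erw [e1, e2]
      rw [pow_succ, pow_two, Finset.sum_mul_sum, ← Finset.sum_product', Finset.sum_mul_sum,
        ← Finset.sum_product', Finset.mul_sum]
      refine Finset.sum_nbij' (fun t => (t.1.1, t.1.2, t.2)) (fun t => ((t.1, t.2.1), t.2.2))
        ?_ ?_ ?_ ?_ ?_
      · intro t ht; simp only [Finset.mem_product] at ht ⊢; tauto
      · intro t ht; simp only [Finset.mem_product] at ht ⊢; tauto
      · intro t _; rfl
      · intro t _; rfl
      · intro t _
        have : basisFn (t.1.1 + t.1.2 + t.2) x * (((2 * Real.pi : ℝ) : ℂ)⁻¹) ^ 2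
            = basisFn t.1.1 x * basisFn t.1.2 x * basisFn t.2 x := by
          change (_ * mono _ x) * _ = (_ * mono _ x) * (_ * mono _ x) * (_ * mono _ x)
          rw [mono_add, mono_add]; ring
        simp only [id]
        push_cast at this ⊢
        linear_combination (-(c t.1.1 * c t.1.2 * c t.2 * ((jb t.1.1 : ℂ)⁻¹ * (jb t.1.2 : ℂ)⁻¹ *
          (jb t.2 : ℂ)⁻¹))) * this
    have h2 : ‖f x‖ ^ (3 : ℝ) = ‖f x ^ 3‖ := by
      rw [norm_pow, show (3 : ℝ) = ((3 : ℕ) : ℝ) by norm_num, Real.rpow_natCast]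
    rw [h2, h1, norm_mul, norm_pow, norm_inv, Complex.norm_real, Real.norm_eq_abs,
      abs_of_pos Real.two_pi_pos]
    refine mul_le_of_le_one_left (norm_nonneg _) (pow_le_one₀ (by positivity) ?_)
    exact inv_le_one_of_one_le₀ (by linarith [Real.pi_gt_three])
  have h1 : eLpNorm f 6 volume ^ (3 : ℝ) ≤ ENNReal.ofReal ‖F‖ := by
    -- The cube of the `L⁶` norm of `f` is the `L²` norm of `|f|³`, which orthogonality can compute.
    have h2 := eLpNorm_norm_rpow (μ := volume) (p := 2) f (q := 3) (by norm_num)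
    have h3 : (2 : ℝ≥0∞) * ENNReal.ofReal 3 = 6 := by
      rw [show ENNReal.ofReal 3 = 3 by simp]; norm_num
    rw [h3] at h2
    rw [← h2, Lp.norm_def, ENNReal.ofReal_toReal (Lp.eLpNorm_ne_top F)]
    refine eLpNorm_mono_ae ?_
    filter_upwards [hae] with x hx
    rwa [Real.norm_eq_abs, abs_of_nonneg (by positivity)]
  have h2 : ‖F‖ ≤ ((1 + 3 * jbSum ^ 2) * M) ^ 3 := by
    refine (sq_le_sq₀ (norm_nonneg _) (by positivity)).mp ((norm_cubic_sum_le S c).trans ?_)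
    have hs : (∑ n ∈ S, ‖c n‖ ^ 2) ^ 3 ≤ (M ^ 2) ^ 3 :=
      pow_le_pow_left₀ (Finset.sum_nonneg fun _ _ => by positivity) hc 3
    -- The crude constant `1 + 3 jbSum²` dominates the sixth root of `3 jbSum²`, so no root has to
    -- appear.
    have hk : 3 * jbSum ^ 2 ≤ (1 + 3 * jbSum ^ 2) ^ 6 := by
      have h6 : 1 + 3 * jbSum ^ 2 ≤ (1 + 3 * jbSum ^ 2) ^ 6 :=
        le_self_pow₀ (by nlinarith [sq_nonneg jbSum]) (by norm_num)
      linarith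
    calc 3 * jbSum ^ 2 * (∑ n ∈ S, ‖c n‖ ^ 2) ^ 3 ≤ (1 + 3 * jbSum ^ 2) ^ 6 * (M ^ 2) ^ 3 :=
          mul_le_mul hk hs (by positivity) (by positivity)
      _ = _ := by ring
  have h3 : eLpNorm f 6 volume ^ (3 : ℝ) ≤ ENNReal.ofReal ((1 + 3 * jbSum ^ 2) * M) ^ (3 : ℝ) := by
    refine h1.trans ((ENNReal.ofReal_le_ofReal h2).trans (le_of_eq ?_))
    rw [ENNReal.ofReal_pow (by positivity), show (3 : ℝ) = ((3 : ℕ) : ℝ) by norm_num,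
      ENNReal.rpow_natCast]
  exact (ENNReal.rpow_le_rpow_iff (by norm_num)).mp h3

theorem norm_jb_inv_le (n : Freq) : ‖(((jb n)⁻¹ : ℝ) : ℂ)‖ ≤ 1 := by
  rw [Complex.norm_real, Real.norm_eq_abs, abs_of_nonneg (inv_nonneg.mpr (jb_pos n).le)]
  exact inv_le_one_of_one_le₀ (one_le_jb n)

/-- The operator `⟨∇⟩⁻¹` on sequences. -/
def jInv : Seq →L[ℝ] Seq := mult (fun n => (((jb n)⁻¹ : ℝ) : ℂ)) ⟨1, norm_jb_inv_le⟩

theorem jInv_apply (c : Seq) (n : Freq) : jInv c n = (((jb n)⁻¹ : ℝ) : ℂ) * c n := rfl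

/-- The real-valued function `Re ⟨∇⟩⁻¹ ∑ c_n e_n`, an element of `H¹`. -/
def smooth : Seq →L[ℝ] L2 := synth.comp jInv

theorem smooth_apply (c : Seq) : smooth c = synth (jInv c) := rfl

/-- The constant in the embedding `H¹ ⊂ L⁶`. -/
def sobConst : ℝ := 1 + 3 * jbSum ^ 2

theorem sobConst_nonneg : 0 ≤ sobConst := by unfold sobConst; positivity

/-- Partial sums converge only in `L²`, but the `L⁶` norm is lower semicontinuous under convergence
in measure, so the bound for finite sums survives in the limit. -/
theorem eLpNorm_smooth_le (c : Seq) :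
    eLpNorm (smooth c) 6 volume ≤ ENNReal.ofReal (sobConst * ‖c‖) := by
  have h1 := torusBasis.hasSum_repr_symm (jInv c)
  have h2 : Tendsto (fun S : Finset Freq => reL2 (∑ n ∈ S, jInv c n • torusBasis n)) atTop
      (𝓝 (smooth c)) := (reL2.continuous.tendsto _).comp h1
  refine eLpNorm_le_of_tendstoInMeasure (.of_forall fun S => ?_)
    (tendstoInMeasure_of_tendsto_Lp h2) (fun S => Lp.aestronglyMeasurable _)
  have h3 : eLpNorm (reL2 (∑ n ∈ S, jInv c n • torusBasis n)) 6 volume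
      ≤ eLpNorm (∑ n ∈ S, jInv c n • torusBasis n : Lp ℂ 2 (volume : Measure Torus)) 6 volume := by
    refine eLpNorm_mono_ae ?_
    filter_upwards [coeFn_reL2 (∑ n ∈ S, jInv c n • torusBasis n)] with x hx
    rw [hx]
    exact Complex.abs_re_le_norm _
  refine h3.trans ?_
  have h4 : ∀ n, jInv c n = c n * (((jb n)⁻¹ : ℝ) : ℂ) := fun n => mul_comm _ _
  simp only [h4]
  refine eLpNorm_six_trig_le S c (norm_nonneg _) ?_
  exact sum_le_hasSum S (fun n _ => by positivity) (seq_hasSum_sq c)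

/-! ### Cubic expressions in `H¹` functions -/

instance holderTriple_six_six_three : ENNReal.HolderTriple 6 6 3 where
  inv_add_inv_eq_inv := by
    rw [← ENNReal.toReal_eq_toReal_iff' (by simp) (by simp), ENNReal.toReal_add (by simp) (by simp)]
    norm_num

instance holderTriple_three_six_two : ENNReal.HolderTriple 3 6 2 where
  inv_add_inv_eq_inv := by
    rw [← ENNReal.toReal_eq_toReal_iff' (by simp) (by simp), ENNReal.toReal_add (by simp) (by simp)]
    norm_num

instance fact_one_le_six : Fact ((1 : ℝ≥0∞) ≤ 6) := ⟨by norm_num⟩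

instance fact_one_le_three : Fact ((1 : ℝ≥0∞) ≤ 3) := ⟨by norm_num⟩

theorem memLp_six_smooth (c : Seq) : MemLp (smooth c) 6 (volume : Measure Torus) :=
  ⟨Lp.aestronglyMeasurable _, (eLpNorm_smooth_le c).trans_lt ENNReal.ofReal_lt_top⟩

/-- The Sobolev embedding `H¹ ⊂ L⁶`. -/
def smoothSix : Seq →L[ℝ] Lp ℝ 6 (volume : Measure Torus) :=
  LinearMap.mkContinuous
    { toFun := fun c => (memLp_six_smooth c).toLp _
      map_add' := fun c d => by
        rw [← MemLp.toLp_add]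
        refine MemLp.toLp_congr _ _ ?_
        rw [map_add]
        exact Lp.coeFn_add _ _
      map_smul' := fun r c => by
        rw [RingHom.id_apply, ← MemLp.toLp_const_smul]
        refine MemLp.toLp_congr _ _ ?_
        rw [map_smul]
        exact Lp.coeFn_smul _ _ } sobConst
    (fun c => by
      refine (Lp.norm_toLp _ (memLp_six_smooth c)).trans_le ?_
      exact ENNReal.toReal_le_of_le_ofReal (mul_nonneg sobConst_nonneg (norm_nonneg _))
        (eLpNorm_smooth_le c))

theorem coeFn_smoothSix (c : Seq) : smoothSix c =ᵐ[volume] smooth c :=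
  MemLp.coeFn_toLp (memLp_six_smooth c)

/-- The product of two `L⁶` functions as an `L³` function. -/
def mulSix : Lp ℝ 6 (volume : Measure Torus) →L[ℝ] Lp ℝ 6 (volume : Measure Torus) →L[ℝ]
    Lp ℝ 3 (volume : Measure Torus) :=
  (ContinuousLinearMap.mul ℝ ℝ).holderL volume 6 6 3

/-- The product of an `L³` and an `L⁶` function as an `L²` function. -/
def mulThreeSix : Lp ℝ 3 (volume : Measure Torus) →L[ℝ] Lp ℝ 6 (volume : Measure Torus) →L[ℝ] L2 :=
  (ContinuousLinearMap.mul ℝ ℝ).holderL volume 3 6 2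

/-- The product of the three `H¹` functions with the given coefficients. -/
def tri (a b c : Seq) : L2 := mulThreeSix (mulSix (smoothSix a) (smoothSix b)) (smoothSix c)

theorem inner_real_eq_mul (a b : ℝ) : inner ℝ a b = a * b := by simp [mul_comm]

theorem coeFn_tri (a b c : Seq) :
    tri a b c =ᵐ[volume] fun x => smooth a x * smooth b x * smooth c x := by
  have h1 := (ContinuousLinearMap.mul ℝ ℝ).coeFn_holder (r := 3) (smoothSix a) (smoothSix b)
  have h2 := (ContinuousLinearMap.mul ℝ ℝ).coeFn_holder (r := 2)
    ((ContinuousLinearMap.mul ℝ ℝ).holder 3 (smoothSix a) (smoothSix b)) (smoothSix c)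
  filter_upwards [h1, h2, coeFn_smoothSix a, coeFn_smoothSix b, coeFn_smoothSix c]
    with x e1 e2 ea eb ec
  refine e2.trans ?_
  rw [ContinuousLinearMap.mul_apply', e1, ContinuousLinearMap.mul_apply', ea, eb, ec]

theorem continuous_tri {α : Type*} [TopologicalSpace α] {a b c : α → Seq} (ha : Continuous a)
    (hb : Continuous b) (hc : Continuous c) : Continuous fun i => tri (a i) (b i) (c i) := by
  unfold tri; fun_prop

/-- Hölder twice, `1/6 + 1/6 = 1/3` and `1/3 + 1/6 = 1/2`, after the embedding into `L⁶`. -/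
theorem exists_norm_tri_le : ∃ K : ℝ, 0 ≤ K ∧ ∀ a b c, ‖tri a b c‖ ≤ K * ‖a‖ * ‖b‖ * ‖c‖ := by
  refine ⟨‖mulThreeSix‖ * ‖mulSix‖ * ‖smoothSix‖ ^ 3, by positivity, fun a b c => ?_⟩
  have ha := smoothSix.le_opNorm a
  have hb := smoothSix.le_opNorm b
  have hc := smoothSix.le_opNorm c
  calc ‖tri a b c‖ ≤ ‖mulThreeSix‖ * ‖mulSix (smoothSix a) (smoothSix b)‖ * ‖smoothSix c‖ :=
        mulThreeSix.le_opNorm₂ _ _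
    _ ≤ ‖mulThreeSix‖ * (‖mulSix‖ * ‖smoothSix a‖ * ‖smoothSix b‖) * ‖smoothSix c‖ := by
        gcongr; exact mulSix.le_opNorm₂ _ _
    _ ≤ ‖mulThreeSix‖ * (‖mulSix‖ * (‖smoothSix‖ * ‖a‖) * (‖smoothSix‖ * ‖b‖)) *
          (‖smoothSix‖ * ‖c‖) := by gcongr
    _ = _ := by ring

theorem tri_sub_tri (a b : Seq) :
    tri a a a - tri b b b = tri (a - b) a a + tri b (a - b) a + tri b b (a - b) := by
  simp only [tri, map_sub, sub_apply]; abel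

attribute [irreducible] tri

theorem tendsto_tri {α : Type*} {l : Filter α} {a b c : α → Seq} {a₀ b₀ c₀ : Seq}
    (ha : Tendsto a l (𝓝 a₀)) (hb : Tendsto b l (𝓝 b₀)) (hc : Tendsto c l (𝓝 c₀)) :
    Tendsto (fun i => tri (a i) (b i) (c i)) l (𝓝 (tri a₀ b₀ c₀)) := by
  have h : Continuous fun p : Seq × Seq × Seq => tri p.1 p.2.1 p.2.2 :=
    continuous_tri continuous_fst (continuous_fst.comp continuous_snd)
      (continuous_snd.comp continuous_snd)
  have h1 := h.tendsto (a₀, b₀, c₀)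
  have h2 : Tendsto (fun i => (a i, b i, c i)) l (𝓝 (a₀, b₀, c₀)) :=
    ha.prodMk_nhds (hb.prodMk_nhds hc)
  exact h1.comp h2

/-- The cube is Lipschitz on bounded sets. -/
theorem exists_norm_cube_sub_le (M : ℝ) : ∃ K : ℝ, 0 ≤ K ∧ ∀ a b : Seq, ‖a‖ ≤ M → ‖b‖ ≤ M →
    ‖tri a a a - tri b b b‖ ≤ K * ‖a - b‖ := by
  obtain ⟨K, hK, h⟩ := exists_norm_tri_le
  refine ⟨3 * K * M ^ 2, by positivity, fun a b ha hb => ?_⟩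
  have hM : 0 ≤ M := (norm_nonneg _).trans ha
  rw [tri_sub_tri]
  have h1 : ‖tri (a - b) a a‖ ≤ K * M ^ 2 * ‖a - b‖ :=
    calc _ ≤ K * ‖a - b‖ * ‖a‖ * ‖a‖ := h _ _ _
      _ ≤ K * ‖a - b‖ * M * M := by gcongr
      _ = _ := by ring
  have h2 : ‖tri b (a - b) a‖ ≤ K * M ^ 2 * ‖a - b‖ :=
    calc _ ≤ K * ‖b‖ * ‖a - b‖ * ‖a‖ := h _ _ _
      _ ≤ K * M * ‖a - b‖ * M := by gcongr
      _ = _ := by ring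
  have h3 : ‖tri b b (a - b)‖ ≤ K * M ^ 2 * ‖a - b‖ :=
    calc _ ≤ K * ‖b‖ * ‖b‖ * ‖a - b‖ := h _ _ _
      _ ≤ K * M * M * ‖a - b‖ := by gcongr
      _ = _ := by ring
  calc _ ≤ ‖tri (a - b) a a‖ + ‖tri b (a - b) a‖ + ‖tri b b (a - b)‖ := norm_add₃_le
    _ ≤ _ := by linarith

/-! ### The quartic energy and the Wick cube -/

/-- The quartic energy `∫ v⁴`. -/
def quartic (c : Seq) : ℝ := inner ℝ (smooth c) (tri c c c)

theorem quartic_eq_integral (c : Seq) :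
    Integrable (fun x => smooth c x ^ 4) (volume : Measure Torus) ∧
      quartic c = ∫ x, smooth c x ^ 4 := by
  have h : (fun x => inner ℝ (smooth c x) (tri c c c x)) =ᵐ[volume] fun x => smooth c x ^ 4 := by
    filter_upwards [coeFn_tri c c c] with x hx
    rw [hx, inner_real_eq_mul]; ring
  exact ⟨(L2.integrable_inner (smooth c) (tri c c c)).congr h, by
    rw [quartic, L2.inner_def]; exact integral_congr_ae h⟩

theorem quartic_nonneg (c : Seq) : 0 ≤ quartic c := by
  rw [(quartic_eq_integral c).2]
  exact integral_nonneg fun x => by positivity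

/-- The factorisation `a⁴ - b⁴ = (a - b)(a³ + a²b + ab² + b³)`, with the second factor in `L²`:
difference quotients then need to converge only in `L²`. -/
theorem quartic_sub (a b : Seq) : quartic a - quartic b
    = inner ℝ (smooth a - smooth b) (tri a a a + tri a a b + tri a b b + tri b b b) := by
  rw [(quartic_eq_integral a).2, (quartic_eq_integral b).2,
    ← integral_sub (quartic_eq_integral a).1 (quartic_eq_integral b).1, L2.inner_def]
  refine integral_congr_ae ?_
  filter_upwards [coeFn_tri a a a, coeFn_tri a a b, coeFn_tri a b b, coeFn_tri b b b,
    Lp.coeFn_sub (smooth a) (smooth b), Lp.coeFn_add (tri a a a + tri a a b + tri a b b) (tri b b b),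
    Lp.coeFn_add (tri a a a + tri a a b) (tri a b b), Lp.coeFn_add (tri a a a) (tri a a b)]
    with x h1 h2 h3 h4 h5 h6 h7 h8
  rw [h5, h6, Pi.add_apply, h7, Pi.add_apply, h8, Pi.add_apply, Pi.sub_apply, h1, h2, h3, h4,
    inner_real_eq_mul]
  ring

/-- Here `v` is differentiable in time only as an `L²` path. That suffices: in `quartic_sub` the
slope converges in `L²`, while the cubic factor converges in `L²` because `ψ` is continuous. -/
theorem hasDerivWithinAt_quartic {ψ : ℝ → Seq} {W : L2} {s : Set ℝ} {t : ℝ}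
    (hψ : ContinuousWithinAt ψ s t) (hV : HasDerivWithinAt (fun u => smooth (ψ u)) W s t) :
    HasDerivWithinAt (fun u => quartic (ψ u)) (4 * inner ℝ W (tri (ψ t) (ψ t) (ψ t))) s t := by
  rw [hasDerivWithinAt_iff_tendsto_slope] at hV ⊢
  have hψ' : Tendsto ψ (𝓝[s \ {t}] t) (𝓝 (ψ t)) := hψ.mono sdiff_subset
  have hc : Tendsto (fun _ : ℝ => ψ t) (𝓝[s \ {t}] t) (𝓝 (ψ t)) := tendsto_const_nhds
  have hB := (((tendsto_tri hψ' hψ' hψ').add (tendsto_tri hψ' hψ' hc)).add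
    (tendsto_tri hψ' hc hc)).add (tendsto_tri hc hc hc)
  have h := hV.inner hB (𝕜 := ℝ)
  convert h using 2
  · rename_i u
    rw [slope_def_module, slope_def_module, quartic_sub, real_inner_smul_left, smul_eq_mul]
  · simp only [inner_add_right]; ring

/-- The renormalised cubic nonlinearity `u³ - 3 σ u`. -/
def wickCube (σ : ℝ) (c : Seq) : L2 := tri c c c - (3 * σ) • smooth c

theorem coeFn_wickCube (σ : ℝ) (c : Seq) :
    wickCube σ c =ᵐ[volume] fun x => smooth c x ^ 3 - 3 * σ * smooth c x := by
  filter_upwards [coeFn_tri c c c, Lp.coeFn_sub (tri c c c) ((3 * σ) • smooth c),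
    Lp.coeFn_smul (3 * σ) (smooth c)] with x h1 h2 h3
  rw [wickCube, h2, Pi.sub_apply, h3, h1, Pi.smul_apply, smul_eq_mul]; ring

theorem continuous_wickCube (σ : ℝ) : Continuous (wickCube σ) :=
  (continuous_tri continuous_id continuous_id continuous_id).sub
    ((3 * σ) • smooth).continuous

theorem norm_jInv_le (c : Seq) : ‖jInv c‖ ≤ ‖c‖ := by
  have := norm_mult_le norm_jb_inv_le c
  rwa [one_mul] at this

theorem norm_smooth_le (c : Seq) : ‖smooth c‖ ≤ ‖c‖ :=
  (norm_synth_le _).trans (norm_jInv_le c)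

theorem exists_norm_wickCube_sub_le (σ M : ℝ) : ∃ K : ℝ, 0 ≤ K ∧ ∀ a b : Seq, ‖a‖ ≤ M → ‖b‖ ≤ M →
    ‖wickCube σ a - wickCube σ b‖ ≤ K * ‖a - b‖ := by
  obtain ⟨K, hK, h⟩ := exists_norm_cube_sub_le M
  refine ⟨K + |3 * σ|, by positivity, fun a b ha hb => ?_⟩
  have e : wickCube σ a - wickCube σ b
      = (tri a a a - tri b b b) - (3 * σ) • smooth (a - b) := by
    rw [wickCube, wickCube, map_sub, smul_sub]; abel
  rw [e, add_mul]
  refine (norm_sub_le _ _).trans (add_le_add (h a b ha hb) ?_)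
  rw [norm_smul, Real.norm_eq_abs]
  exact mul_le_mul_of_nonneg_left (norm_smooth_le _) (abs_nonneg _)

theorem L2_norm_sq (f : L2) : Integrable (fun x => f x ^ 2) (volume : Measure Torus) ∧
    ‖f‖ ^ 2 = ∫ x, f x ^ 2 := by
  have h : ∀ x, inner ℝ (f x) (f x) = f x ^ 2 := fun x => by rw [inner_real_eq_mul, sq]
  have h1 := L2.integrable_inner (𝕜 := ℝ) f f
  simp only [h] at h1
  refine ⟨h1, ?_⟩
  rw [← real_inner_self_eq_norm_sq, L2.inner_def]
  simp only [h]

/-- All terms of the nonlinearity other than `v³` are controlled by the quartic energy. -/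
theorem exists_norm_wickCube_sub_cube_le (σ Z : ℝ) : ∃ K : ℝ, 0 ≤ K ∧ ∀ c z : Seq,
    (∀ᵐ x ∂(volume : Measure Torus), |smooth z x| ≤ Z) →
    ‖wickCube σ (c + z) - tri c c c‖ ^ 2 ≤ K * (1 + quartic c) := by
  set K₀ : ℝ := 3 * |Z| + 3 * |Z| ^ 2 + |Z| ^ 3 + 3 * |σ| + 3 * |σ| * |Z| with hK₀
  have hK₀n : 0 ≤ K₀ := by positivity
  set ν : ℝ := (volume : Measure Torus).real univ with hν
  have hνn : 0 ≤ ν := measureReal_nonneg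
  refine ⟨2 * K₀ ^ 2 * (1 + ν), by positivity, fun c z hz => ?_⟩
  obtain ⟨hi4, he4⟩ := quartic_eq_integral c
  obtain ⟨hi2, he2⟩ := L2_norm_sq (wickCube σ (c + z) - tri c c c)
  have hq := quartic_nonneg c
  have hint : Integrable (fun x => 2 * K₀ ^ 2 * (1 + smooth c x ^ 4)) (volume : Measure Torus) :=
    ((integrable_const 1).add hi4).const_mul _
  have hle : ‖wickCube σ (c + z) - tri c c c‖ ^ 2 ≤ ∫ x, 2 * K₀ ^ 2 * (1 + smooth c x ^ 4) := by
    rw [he2]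
    refine integral_mono_ae hi2 hint ?_
    filter_upwards [hz, coeFn_wickCube σ (c + z), coeFn_tri c c c,
      Lp.coeFn_sub (wickCube σ (c + z)) (tri c c c), Lp.coeFn_add (smooth c) (smooth z)]
      with x h1 h2 h3 h4 h5
    rw [h4, Pi.sub_apply, h2, h3, map_add, h5, Pi.add_apply]
    generalize smooth c x = v
    generalize smooth z x = y at h1
    have hy : |y| ≤ |Z| := h1.trans (le_abs_self Z)
    have hv : |v| ≤ 1 + v ^ 2 := by
      rw [abs_le]; constructor <;> nlinarith [sq_nonneg (v + 1), sq_nonneg (v - 1), sq_nonneg v]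
    have hv1 : 1 ≤ 1 + v ^ 2 := by nlinarith [sq_nonneg v]
    have hv2 : v ^ 2 ≤ 1 + v ^ 2 := by linarith
    -- The cube of `v` cancels, so every remaining monomial is at most quadratic in `v`, with
    -- coefficients bounded through `|y| ≤ |Z|` and `|σ|`. Squaring then costs only `v⁴`.
    have hb : |(v + y) ^ 3 - 3 * σ * (v + y) - v * v * v| ≤ K₀ * (1 + v ^ 2) := by
      have e : (v + y) ^ 3 - 3 * σ * (v + y) - v * v * v
          = 3 * y * v ^ 2 + 3 * y ^ 2 * v + y ^ 3 - 3 * σ * v - 3 * σ * y := by ring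
      have t1 : |3 * y * v ^ 2| ≤ 3 * |Z| * (1 + v ^ 2) := by
        rw [abs_mul, abs_mul, abs_of_pos (three_pos : (0 : ℝ) < 3), abs_of_nonneg (sq_nonneg v)]
        gcongr
      have t2 : |3 * y ^ 2 * v| ≤ 3 * |Z| ^ 2 * (1 + v ^ 2) := by
        rw [abs_mul, abs_mul, abs_of_pos (three_pos : (0 : ℝ) < 3), abs_pow]
        gcongr
      have t3 : |y ^ 3| ≤ |Z| ^ 3 * (1 + v ^ 2) := by
        rw [abs_pow]
        calc |y| ^ 3 ≤ |Z| ^ 3 * 1 := by rw [mul_one]; gcongr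
          _ ≤ _ := by gcongr
      have t4 : |3 * σ * v| ≤ 3 * |σ| * (1 + v ^ 2) := by
        rw [abs_mul, abs_mul, abs_of_pos (three_pos : (0 : ℝ) < 3)]
        gcongr
      have t5 : |3 * σ * y| ≤ 3 * |σ| * |Z| * (1 + v ^ 2) := by
        rw [abs_mul, abs_mul, abs_of_pos (three_pos : (0 : ℝ) < 3)]
        calc 3 * |σ| * |y| ≤ 3 * |σ| * |Z| * 1 := by rw [mul_one]; gcongr
          _ ≤ _ := by gcongr
      rw [e, hK₀]
      rw [abs_le] at *
      constructor <;> linarith [t1.1, t1.2, t2.1, t2.2, t3.1, t3.2, t4.1, t4.2, t5.1, t5.2]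
    calc _ = |(v + y) ^ 3 - 3 * σ * (v + y) - v * v * v| ^ 2 := (sq_abs _).symm
      _ ≤ (K₀ * (1 + v ^ 2)) ^ 2 := pow_le_pow_left₀ (abs_nonneg _) hb 2
      _ = K₀ ^ 2 * (1 + v ^ 2) ^ 2 := by ring
      _ ≤ K₀ ^ 2 * (2 * (1 + v ^ 4)) :=
          mul_le_mul_of_nonneg_left (by nlinarith [sq_nonneg (v ^ 2 - 1)]) (sq_nonneg _)
      _ = _ := by ring
  refine hle.trans ?_
  rw [integral_const_mul, integral_add (integrable_const 1) hi4, ← he4, integral_const,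
    smul_eq_mul, mul_one, mul_assoc (2 * K₀ ^ 2)]
  refine mul_le_mul_of_nonneg_left ?_ (by positivity)
  nlinarith [mul_nonneg hνn hq]

/-! ### The first-order formulation -/

/-- Evaluation of a sequence at a frequency. -/
def seqEval (n : Freq) : Seq →L[ℝ] ℂ :=
  LinearMap.mkContinuous
    { toFun := fun c => c n
      map_add' := fun _ _ => rfl
      map_smul' := fun _ _ => rfl } 1
    (fun c => by rw [one_mul]; exact lp.norm_apply_le_norm (by norm_num) c n)

theorem seqEval_apply (n : Freq) (c : Seq) : seqEval n c = c n := rfl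

/-- The Fourier coefficient as a continuous linear map. -/
def coeffL (n : Freq) : L2 →L[ℝ] ℂ := (seqEval n).comp fourierSeq.toContinuousLinearMap

theorem coeffL_apply (n : Freq) (f : L2) : coeffL n f = coeff f n := fourierSeq_apply f n

theorem norm_mult_of_norm_one {m : Freq → ℂ} (hm : ∀ n, ‖m n‖ = 1) (c : Seq) :
    ‖mult m ⟨1, fun n => (hm n).le⟩ c‖ = ‖c‖ := by
  refine (sq_eq_sq₀ (norm_nonneg _) (norm_nonneg _)).mp ?_
  refine (seq_hasSum_sq _).unique ?_
  convert seq_hasSum_sq c using 2 with n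
  rw [mult_apply, norm_mul, hm, one_mul]

theorem inner_mult_mult {m : Freq → ℂ} (hm : ∀ n, ‖m n‖ = 1) (c d : Seq) :
    inner ℝ (mult m ⟨1, fun n => (hm n).le⟩ c) (mult m ⟨1, fun n => (hm n).le⟩ d)
      = inner ℝ c d :=
  LinearIsometry.inner_map_map
    ⟨(mult m ⟨1, fun n => (hm n).le⟩ : Seq →ₗ[ℝ] Seq), norm_mult_of_norm_one hm⟩ c d

theorem norm_rotSymbol (t : ℝ) (n : Freq) :
    ‖Complex.exp (((-(t * jb n) : ℝ) : ℂ) * Complex.I)‖ = 1 :=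
  Complex.norm_exp_ofReal_mul_I _

/-- The unitary group `e^{-it⟨∇⟩}`. -/
def rot (t : ℝ) : Seq →L[ℝ] Seq :=
  mult (fun n => Complex.exp (((-(t * jb n) : ℝ) : ℂ) * Complex.I))
    ⟨1, fun n => (norm_rotSymbol t n).le⟩

theorem rot_apply (t : ℝ) (c : Seq) (n : Freq) :
    rot t c n = Complex.exp (((-(t * jb n) : ℝ) : ℂ) * Complex.I) * c n := rfl

theorem norm_rot (t : ℝ) (c : Seq) : ‖rot t c‖ = ‖c‖ := norm_mult_of_norm_one (norm_rotSymbol t) c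

theorem inner_rot_rot (t : ℝ) (c d : Seq) : inner ℝ (rot t c) (rot t d) = inner ℝ c d :=
  inner_mult_mult (norm_rotSymbol t) c d

theorem rot_rot_neg (t : ℝ) (c : Seq) : rot t (rot (-t) c) = c := by
  ext n
  rw [rot_apply, rot_apply, ← mul_assoc, ← Complex.exp_add]
  have : ((-(t * jb n) : ℝ) : ℂ) * Complex.I + ((-(-t * jb n) : ℝ) : ℂ) * Complex.I = 0 := by
    push_cast; ring
  rw [this, Complex.exp_zero, one_mul]

theorem rot_zero (c : Seq) : rot 0 c = c := by
  ext n
  simp [rot_apply]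

/-- Joint continuity holds in the strong sense, which is all that is available: the frequencies
`⟨n⟩` are unbounded. -/
theorem continuous_rot : Continuous fun p : ℝ × Seq => rot p.1 p.2 := by
  rw [continuous_iff_continuousAt]
  rintro ⟨t, c⟩
  have hpt : ∀ n, Tendsto (fun p : ℝ × Seq => Complex.exp (((-(p.1 * jb n) : ℝ) : ℂ) * Complex.I))
      (𝓝 (t, c)) (𝓝 (Complex.exp (((-(t * jb n) : ℝ) : ℂ) * Complex.I))) := fun n => by
    have h : Continuous fun p : ℝ × Seq =>
        Complex.exp (((-(p.1 * jb n) : ℝ) : ℂ) * Complex.I) := by fun_prop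
    exact h.tendsto (t, c)
  have h := tendsto_mult (l := 𝓝 (t, c)) (c := fun p : ℝ × Seq => p.2)
    (fun (p : ℝ × Seq) n => (norm_rotSymbol p.1 n).le) (fun n => (norm_rotSymbol t n).le) hpt
    (continuous_snd.tendsto (t, c))
  exact h

attribute [irreducible] rot

theorem norm_neg_I (_ : Freq) : ‖-Complex.I‖ = 1 := by simp

/-- Multiplication by `-i`. -/
def negI : Seq →L[ℝ] Seq := mult (fun _ => -Complex.I) ⟨1, fun n => (norm_neg_I n).le⟩

theorem negI_apply (c : Seq) (n : Freq) : negI c n = -Complex.I * c n := rfl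

theorem norm_negI (c : Seq) : ‖negI c‖ = ‖c‖ := norm_mult_of_norm_one norm_neg_I c

/-- The velocity `∂_t v = Im ψ`, where `ψ = ⟨∇⟩ v + i ∂_t v`. -/
def vel : Seq →L[ℝ] L2 := synth.comp negI

theorem vel_apply (c : Seq) : vel c = synth (negI c) := rfl

theorem norm_vel_le (c : Seq) : ‖vel c‖ ≤ ‖c‖ := (norm_synth_le _).trans (norm_negI c).le

/-- Multiplication by `-i` is an isometry, so it can be moved to the other side of the pairing,
where it extracts the imaginary part `∂_t v`. -/
theorem inner_negI_fourierSeq (c : Seq) (f : L2) :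
    inner ℝ c (negI (fourierSeq f)) = - inner ℝ (vel c) f := by
  have h : c = negI (-(negI c)) := by
    ext n
    rw [negI_apply, lp.coeFn_neg, Pi.neg_apply, negI_apply, mul_neg, ← mul_assoc, neg_mul_neg,
      Complex.I_mul_I]
    ring
  have h2 : inner ℝ (negI (-(negI c))) (negI (fourierSeq f))
      = inner ℝ (-(negI c)) (fourierSeq f) := inner_mult_mult norm_neg_I _ _
  rw [← h] at h2
  rw [h2, inner_neg_left, inner_fourierSeq, vel_apply]

theorem coeff_smooth (c : Seq) (n : Freq) :
    coeff (smooth c) n = (((jb n)⁻¹ : ℝ) : ℂ) * ((c n + conj (c (-n))) / 2) := by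
  rw [smooth_apply, coeff_synth, jInv_apply, jInv_apply, jb_neg, map_mul, Complex.conj_ofReal]
  ring

theorem coeff_vel (c : Seq) (n : Freq) :
    coeff (vel c) n = (-Complex.I * c n + Complex.I * conj (c (-n))) / 2 := by
  rw [vel_apply, coeff_synth, negI_apply, negI_apply, map_mul, map_neg, Complex.conj_I, neg_neg]

theorem jb_mul_coeff_smooth (c : Seq) (n : Freq) :
    (jb n : ℂ) * coeff (smooth c) n = coeff (synth c) n := by
  have : (jb n : ℂ) ≠ 0 := by exact_mod_cast (jb_pos n).ne'
  rw [coeff_smooth, coeff_synth]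
  push_cast
  rw [← mul_assoc, mul_inv_cancel₀ this, one_mul]

/-- A path in `L²` whose Fourier coefficients are differentiable, with the coefficients of a
continuous path as derivatives, is differentiable. -/
theorem hasDerivWithinAt_of_coeff {T : ℝ} (hT : 0 < T) {V W : ℝ → L2}
    (hW : ContinuousOn W (Icc 0 T))
    (h : ∀ n, ∀ t ∈ Icc 0 T,
      HasDerivWithinAt (fun s => coeff (V s) n) (coeff (W t) n) (Icc 0 T) t) :
    ∀ t ∈ Icc 0 T, HasDerivWithinAt V (W t) (Icc 0 T) t := by
  -- Extending `W` continuously to the whole line makes its primitive differentiable at the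
  -- endpoints as well.
  set W' : ℝ → L2 := IccExtend hT.le ((Icc 0 T).domRestrict W) with hW'
  have hWc : Continuous W' := (continuousOn_iff_continuous_domRestrict.mp hW).Icc_extend'
  have hWe : ∀ t ∈ Icc 0 T, W' t = W t := fun t ht => IccExtend_of_mem _ _ ht
  set F : ℝ → L2 := fun t => V 0 + ∫ s in (0 : ℝ)..t, W' s with hF
  have hFd : ∀ t, HasDerivAt F (W' t) t := fun t =>
    (intervalIntegral.integral_hasDerivAt_right (hWc.intervalIntegrable _ _)
      (hWc.stronglyMeasurableAtFilter _ _) hWc.continuousAt).const_add _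
  -- The path `V` and the primitive of `W` agree at 0, and each coefficient of their difference has
  -- zero derivative.
  have hVF : ∀ t ∈ Icc 0 T, V t = F t := by
    intro t ht
    refine L2_ext_coeff fun n => ?_
    have hd : ∀ s ∈ Icc 0 T, HasDerivWithinAt (fun s => coeff (V s) n - coeff (F s) n) 0
        (Icc 0 T) s := by
      intro s hs
      have h1 := ((coeffL n).hasFDerivAt (x := F s)).comp_hasDerivWithinAt s
        ((hFd s).hasDerivWithinAt (s := Icc 0 T))
      have h2 := (h n s hs).sub h1
      simp only [Function.comp_def, coeffL_apply, hWe s hs, sub_self] at h2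
      exact h2
    have hc := constant_of_derivWithin_zero (fun s hs => (hd s hs).differentiableWithinAt)
      (fun s hs => (hd s (Ico_subset_Icc_self hs)).derivWithin
        (uniqueDiffOn_Icc hT s (Ico_subset_Icc_self hs))) t ht
    have h0 : F 0 = V 0 := by simp [hF]
    rw [h0, sub_self] at hc
    exact sub_eq_zero.mp hc
  intro t ht
  rw [← hWe t ht]
  exact ((hFd t).hasDerivWithinAt).congr hVF (hVF t ht)

/-- `U` solves the interaction-picture form of `ψ' = -i⟨∇⟩ψ - i f`, `ψ(t) = e^{-it⟨∇⟩} U(t)`. -/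
def Evolves (T : ℝ) (f : ℝ → L2) (U : ℝ → Seq) : Prop :=
  ∀ t ∈ Icc 0 T, HasDerivWithinAt U (rot (-t) (negI (fourierSeq (f t)))) (Icc 0 T) t

/-! ### Equations for the Fourier modes and the energy identity -/

section Evolves

variable {T : ℝ} {f : ℝ → L2} {U : ℝ → Seq}

theorem Evolves.continuousOn (h : Evolves T f U) : ContinuousOn U (Icc 0 T) :=
  fun t ht => (h t ht).continuousWithinAt

theorem Evolves.continuousOn_rot (h : Evolves T f U) :
    ContinuousOn (fun t => rot t (U t)) (Icc 0 T) :=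
  continuous_rot.comp_continuousOn (continuousOn_id.prodMk h.continuousOn)

/-- The path `ψ` itself need not be differentiable in `ℓ²`, since `⟨∇⟩` is unbounded, but at a fixed
frequency the phase is smooth and the product rule undoes the interaction picture. -/
theorem Evolves.hasDeriv_mode (h : Evolves T f U) (n : Freq) {t : ℝ} (ht : t ∈ Icc 0 T) :
    HasDerivWithinAt (fun s => rot s (U s) n)
      (-Complex.I * jb n * rot t (U t) n - Complex.I * coeff (f t) n) (Icc 0 T) t := by
  have h1 := ((seqEval n).hasFDerivAt (x := U t)).comp_hasDerivWithinAt t (h t ht)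
  have h2 : HasDerivAt (fun s : ℝ => Complex.exp (((-(s * jb n) : ℝ) : ℂ) * Complex.I))
      (Complex.exp (((-(t * jb n) : ℝ) : ℂ) * Complex.I) * (((-(1 * jb n) : ℝ) : ℂ) * Complex.I))
      t :=
    ((((hasDerivAt_id t).mul_const (jb n)).neg.ofReal_comp).mul_const Complex.I).cexp
  have h3 := (h2.hasDerivWithinAt (s := Icc 0 T)).mul h1
  have hfun : (fun s => rot s (U s) n) =
      (fun s : ℝ => Complex.exp (((-(s * jb n) : ℝ) : ℂ) * Complex.I)) * ⇑(seqEval n) ∘ U := by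
    ext s
    rw [rot_apply]; rfl
  rw [hfun]
  refine h3.congr_deriv ?_
  have e : Complex.exp (((-(t * jb n) : ℝ) : ℂ) * Complex.I) *
      seqEval n (rot (-t) (negI (fourierSeq (f t)))) = -Complex.I * coeff (f t) n := by
    have := congrArg (fun c : Seq => c n) (rot_rot_neg t (negI (fourierSeq (f t))))
    simp only [rot_apply t, negI_apply, fourierSeq_apply] at this
    exact this
  rw [e]
  simp only [Function.comp_apply, seqEval_apply, rot_apply]
  push_cast
  ring

/-- Real and imaginary parts couple the mode `n` with the conjugate of the mode `-n`; the system
closes because `f` is real-valued. -/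
theorem Evolves.hasDeriv_mode_conj (h : Evolves T f U) (n : Freq) {t : ℝ} (ht : t ∈ Icc 0 T) :
    HasDerivWithinAt (fun s => conj (rot s (U s) (-n)))
      (Complex.I * jb n * conj (rot t (U t) (-n)) + Complex.I * coeff (f t) n) (Icc 0 T) t := by
  have h1 := (Complex.conjCLE.toContinuousLinearMap.hasFDerivAt
    (x := rot t (U t) (-n))).comp_hasDerivWithinAt t (h.hasDeriv_mode (-n) ht)
  refine h1.congr_deriv ?_
  change conj (-Complex.I * jb (-n) * rot t (U t) (-n) - Complex.I * coeff (f t) (-n)) = _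
  rw [coeff_neg, jb_neg, map_sub, map_mul, map_mul, map_mul, map_neg, Complex.conj_I,
    Complex.conj_conj, Complex.conj_ofReal]
  ring

theorem Evolves.hasDeriv_coeff_smooth (h : Evolves T f U) (n : Freq) {t : ℝ}
    (ht : t ∈ Icc 0 T) :
    HasDerivWithinAt (fun s => coeff (smooth (rot s (U s))) n) (coeff (vel (rot t (U t))) n)
      (Icc 0 T) t := by
  simp only [coeff_smooth]
  have hj : (jb n : ℂ) ≠ 0 := by exact_mod_cast (jb_pos n).ne'
  have h1 := ((((h.hasDeriv_mode n ht).add (h.hasDeriv_mode_conj n ht)).div_const 2).const_mul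
    (((jb n)⁻¹ : ℝ) : ℂ))
  refine h1.congr_deriv ?_
  rw [coeff_vel]
  push_cast
  field_simp
  ring

theorem Evolves.hasDeriv_coeff_vel (h : Evolves T f U) (n : Freq) {t : ℝ} (ht : t ∈ Icc 0 T) :
    HasDerivWithinAt (fun s => coeff (vel (rot s (U s))) n)
      (-(jb n : ℂ) ^ 2 * coeff (smooth (rot t (U t))) n - coeff (f t) n) (Icc 0 T) t := by
  simp only [coeff_vel]
  have hj : (jb n : ℂ) ≠ 0 := by exact_mod_cast (jb_pos n).ne'
  have h1 := (((h.hasDeriv_mode n ht).const_mul (-Complex.I)).add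
    ((h.hasDeriv_mode_conj n ht).const_mul Complex.I)).div_const 2
  refine h1.congr_deriv ?_
  rw [coeff_smooth]
  push_cast
  field_simp
  linear_combination (jb n * rot t (U t) n + jb n * conj (rot t (U t) (-n))
    + 2 * coeff (f t) n) * Complex.I_sq

theorem Evolves.hasDeriv_smooth (hT : 0 < T) (h : Evolves T f U) {t : ℝ} (ht : t ∈ Icc 0 T) :
    HasDerivWithinAt (fun s => smooth (rot s (U s))) (vel (rot t (U t))) (Icc 0 T) t :=
  hasDerivWithinAt_of_coeff hT (W := fun s => vel (rot s (U s)))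
    (vel.continuous.comp_continuousOn h.continuousOn_rot)
    (fun n _ hs => h.hasDeriv_coeff_smooth n hs) t ht

/-- The energy identity. -/
theorem Evolves.hasDeriv_energy (hT : 0 < T) (h : Evolves T f U) {t : ℝ} (ht : t ∈ Icc 0 T) :
    HasDerivWithinAt (fun s => ‖U s‖ ^ 2 / 2 + quartic (rot s (U s)) / 4)
      (inner ℝ (vel (rot t (U t))) (tri (rot t (U t)) (rot t (U t)) (rot t (U t)) - f t))
      (Icc 0 T) t := by
  have h1 := ((h t ht).norm_sq).div_const 2
  have h2 := (hasDerivWithinAt_quartic (ψ := fun s => rot s (U s)) (h.continuousOn_rot t ht)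
    (h.hasDeriv_smooth hT ht)).div_const 4
  refine (h1.add h2).congr_deriv ?_
  -- The free rotation is an isometry and drops out, leaving `⟨ψ, -if⟩ = -⟨∂_t v, f⟩`; the quartic
  -- term supplies `⟨∂_t v, v³⟩`.
  have e : inner ℝ (U t) (rot (-t) (negI (fourierSeq (f t)))) = - inner ℝ (vel (rot t (U t))) (f t) := by
    rw [← inner_rot_rot t, rot_rot_neg, inner_negI_fourierSeq]
  rw [e, inner_sub_right]
  ring

end Evolves

/-! ### Global solutions of the first-order equation -/

/-- The radial projection onto the ball of radius `R`. -/
def radial (R : ℝ) (c : Seq) : Seq := (R / max R ‖c‖) • c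

theorem norm_radial_le {R : ℝ} (hR : 0 < R) (c : Seq) : ‖radial R c‖ ≤ R := by
  have hm : 0 < max R ‖c‖ := lt_max_of_lt_left hR
  rw [radial, norm_smul, Real.norm_eq_abs, abs_of_pos (by positivity), div_mul_eq_mul_div,
    div_le_iff₀ hm]
  exact mul_le_mul_of_nonneg_left (le_max_right _ _) hR.le

theorem radial_of_norm_le {R : ℝ} (hR : 0 < R) {c : Seq} (h : ‖c‖ ≤ R) : radial R c = c := by
  rw [radial, max_eq_left h, div_self hR.ne', one_smul]

/-- One `‖c - d‖` comes from moving the vector at a fixed scaling factor, the other from the change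
of the factor; the sharp constant is not needed. -/
theorem norm_radial_sub_le {R : ℝ} (hR : 0 < R) (c d : Seq) :
    ‖radial R c - radial R d‖ ≤ 2 * ‖c - d‖ := by
  have hc : 0 < max R ‖c‖ := lt_max_of_lt_left hR
  have hd : 0 < max R ‖d‖ := lt_max_of_lt_left hR
  have e : radial R c - radial R d
      = (R / max R ‖c‖) • (c - d) + (R / max R ‖c‖ - R / max R ‖d‖) • d := by
    rw [radial, radial, smul_sub, sub_smul]; abel
  have h1 : ‖(R / max R ‖c‖) • (c - d)‖ ≤ ‖c - d‖ := by
    rw [norm_smul, Real.norm_eq_abs, abs_of_pos (by positivity)]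
    exact mul_le_of_le_one_left (norm_nonneg _) ((div_le_one hc).mpr (le_max_left _ _))
  have h2 : ‖(R / max R ‖c‖ - R / max R ‖d‖) • d‖ ≤ ‖c - d‖ := by
    have e2 : R / max R ‖c‖ - R / max R ‖d‖
        = (max R ‖d‖ - max R ‖c‖) * (R / max R ‖c‖ / max R ‖d‖) := by
      field_simp
    have h3 : |max R ‖d‖ - max R ‖c‖| ≤ ‖c - d‖ :=
      calc |max R ‖d‖ - max R ‖c‖| ≤ max |R - R| |‖d‖ - ‖c‖| := abs_max_sub_max_le_max _ _ _ _
        _ ≤ ‖c - d‖ := by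
            rw [sub_self, abs_zero, max_eq_right (abs_nonneg _), abs_sub_comm]
            exact abs_norm_sub_norm_le c d
    have h4 : R / max R ‖c‖ / max R ‖d‖ * ‖d‖ ≤ 1 := by
      rw [div_mul_eq_mul_div, div_le_one hd]
      calc R / max R ‖c‖ * ‖d‖ ≤ 1 * ‖d‖ := by
            gcongr; exact (div_le_one hc).mpr (le_max_left _ _)
        _ ≤ max R ‖d‖ := by rw [one_mul]; exact le_max_right _ _
    rw [norm_smul, e2, Real.norm_eq_abs, abs_mul,
      abs_of_pos (by positivity : 0 < R / max R ‖c‖ / max R ‖d‖), mul_assoc]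
    exact (mul_le_mul h3 h4 (by positivity) (norm_nonneg _)).trans (mul_one _).le
  rw [e, two_mul]
  exact (norm_add_le _ _).trans (add_le_add h1 h2)

/-- The forcing `∂_t v + (λ - 1) v + (v + z)³ - 3 σ (v + z)` in terms of `ψ = ⟨∇⟩ v + i ∂_t v` and
`ζ = ⟨∇⟩ z`. -/
def force (lam σ : ℝ) (ζ : ℝ → Seq) (t : ℝ) (ψ : Seq) : L2 :=
  vel ψ + (lam - 1) • smooth ψ + wickCube σ (ψ + ζ t)

theorem continuous_force (lam σ : ℝ) {ζ : ℝ → Seq} (hζ : Continuous ζ) :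
    Continuous fun p : ℝ × Seq => force lam σ ζ p.1 p.2 := by
  have h1 : Continuous fun p : ℝ × Seq => p.2 + ζ p.1 :=
    continuous_snd.add (hζ.comp continuous_fst)
  exact ((vel.continuous.comp continuous_snd).add
    (((lam - 1) • smooth).continuous.comp continuous_snd)).add ((continuous_wickCube σ).comp h1)

theorem exists_norm_le_of_continuous {ζ : ℝ → Seq} (hζ : Continuous ζ) (T : ℝ) :
    ∃ B : ℝ, 0 ≤ B ∧ ∀ t ∈ Icc 0 T, ‖ζ t‖ ≤ B := by
  obtain ⟨B, hB⟩ := (isCompact_Icc (a := (0 : ℝ)) (b := T)).exists_bound_of_continuousOn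
    hζ.continuousOn
  exact ⟨max B 0, le_max_right _ _, fun t ht => (hB t ht).trans (le_max_left _ _)⟩

theorem exists_norm_force_sub_le (lam σ : ℝ) {ζ : ℝ → Seq} (hζ : Continuous ζ) (T M : ℝ) :
    ∃ K : ℝ, 0 ≤ K ∧ ∀ t ∈ Icc 0 T, ∀ a b : Seq, ‖a‖ ≤ M → ‖b‖ ≤ M →
      ‖force lam σ ζ t a - force lam σ ζ t b‖ ≤ K * ‖a - b‖ := by
  obtain ⟨B, hB0, hB⟩ := exists_norm_le_of_continuous hζ T
  obtain ⟨K, hK, h⟩ := exists_norm_wickCube_sub_le σ (M + B)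
  refine ⟨1 + |lam - 1| + K, by positivity, fun t ht a b ha hb => ?_⟩
  have h1 := h (a + ζ t) (b + ζ t) ((norm_add_le _ _).trans (add_le_add ha (hB t ht)))
    ((norm_add_le _ _).trans (add_le_add hb (hB t ht)))
  rw [add_sub_add_right_eq_sub] at h1
  have e : force lam σ ζ t a - force lam σ ζ t b = vel (a - b) + (lam - 1) • smooth (a - b)
      + (wickCube σ (a + ζ t) - wickCube σ (b + ζ t)) := by
    rw [force, force, map_sub, map_sub, smul_sub]; abel
  rw [e, add_mul, add_mul, one_mul]
  refine norm_add₃_le.trans (add_le_add (add_le_add (norm_vel_le _) ?_) h1)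
  rw [norm_smul, Real.norm_eq_abs]
  exact mul_le_mul_of_nonneg_left (norm_smooth_le _) (abs_nonneg _)

attribute [irreducible] force

/-- The vector field of the truncated equation in the interaction picture. -/
def truncField (lam σ : ℝ) (ζ : ℝ → Seq) (R t : ℝ) (c : Seq) : Seq :=
  rot (-t) (negI (fourierSeq (force lam σ ζ t (radial R (rot t c)))))

theorem norm_truncField_sub (lam σ : ℝ) (ζ : ℝ → Seq) (R t : ℝ) (c d : Seq) :
    ‖truncField lam σ ζ R t c - truncField lam σ ζ R t d‖
      = ‖force lam σ ζ t (radial R (rot t c)) - force lam σ ζ t (radial R (rot t d))‖ := by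
  rw [truncField, truncField, ← map_sub, ← map_sub, ← map_sub, norm_rot, norm_negI,
    LinearIsometry.norm_map]

theorem norm_truncField (lam σ : ℝ) (ζ : ℝ → Seq) (R t : ℝ) (c : Seq) :
    ‖truncField lam σ ζ R t c‖ = ‖force lam σ ζ t (radial R (rot t c))‖ := by
  rw [truncField, norm_rot, norm_negI, LinearIsometry.norm_map]

theorem continuous_radial {R : ℝ} (hR : 0 < R) : Continuous (radial R) := by
  have : LipschitzWith 2 (radial R) := LipschitzWith.of_dist_le_mul fun c d => by
    rw [dist_eq_norm, dist_eq_norm]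
    exact norm_radial_sub_le hR c d
  exact this.continuous

theorem continuous_truncField (lam σ : ℝ) {ζ : ℝ → Seq} (hζ : Continuous ζ) {R : ℝ} (hR : 0 < R)
    (c : Seq) : Continuous fun t => truncField lam σ ζ R t c := by
  have h1 : Continuous fun t : ℝ => radial R (rot t c) :=
    (continuous_radial hR).comp (continuous_rot.comp (continuous_id.prodMk continuous_const))
  have h2 := (continuous_force lam σ hζ).comp (continuous_id.prodMk h1)
  have h3 := negI.continuous.comp (fourierSeq.continuous.comp h2)
  have h4 := continuous_rot.comp (continuous_neg.prodMk h3)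
  exact h4

/-- The truncated equation has a solution on `[0,T]`. -/
theorem exists_evolves_trunc (lam σ : ℝ) {ζ : ℝ → Seq} (hζ : Continuous ζ) {T : ℝ} (hT : 0 < T)
    {R : ℝ} (hR : 0 < R) (ψ₀ : Seq) :
    ∃ U : ℝ → Seq, U 0 = ψ₀ ∧
      Evolves T (fun t => force lam σ ζ t (radial R (rot t (U t)))) U := by
  obtain ⟨K, hK, hLip⟩ := exists_norm_force_sub_le lam σ hζ T R
  have hf0 : Continuous fun t => force lam σ ζ t 0 :=
    (continuous_force lam σ hζ).comp (continuous_id.prodMk continuous_const)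
  obtain ⟨L₀, hL₀⟩ := (isCompact_Icc (a := (0 : ℝ)) (b := T)).exists_bound_of_continuousOn
    hf0.continuousOn
  have hL₀n : 0 ≤ L₀ := (norm_nonneg _).trans (hL₀ 0 ⟨le_rfl, hT.le⟩)
  -- The truncated field is bounded by `L₀ + K R` and `2K`-Lipschitz everywhere (2 from `radial`),
  -- so a ball of radius `(L₀ + K R) T` confines the solution on the whole interval. The radius 0
  -- fixes the initial point.
  have hPL : IsPicardLindelof (truncField lam σ ζ R) (tmin := 0) (tmax := T)
      ⟨0, ⟨le_rfl, hT.le⟩⟩ ψ₀ ((L₀ + K * R).toNNReal * T.toNNReal) 0 (L₀ + K * R).toNNReal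
      (K * 2).toNNReal := by
    constructor
    · intro t ht
      refine LipschitzOnWith.of_dist_le_mul fun c _ d _ => ?_
      rw [dist_eq_norm, dist_eq_norm, norm_truncField_sub, Real.coe_toNNReal _ (by positivity)]
      refine (hLip t ht _ _ (norm_radial_le hR _) (norm_radial_le hR _)).trans ?_
      have h1 := norm_radial_sub_le hR (rot t c) (rot t d)
      rw [← map_sub, norm_rot] at h1
      rw [mul_assoc]
      exact mul_le_mul_of_nonneg_left h1 hK
    · intro c _
      exact (continuous_truncField lam σ hζ hR c).continuousOn
    · intro t ht c _
      have h2 := hLip t ht (radial R (rot t c)) 0 (norm_radial_le hR _) (by simpa using hR.le)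
      rw [sub_zero] at h2
      rw [norm_truncField, Real.coe_toNNReal _ (by positivity)]
      calc ‖force lam σ ζ t (radial R (rot t c))‖
          ≤ ‖force lam σ ζ t 0‖
            + ‖force lam σ ζ t (radial R (rot t c)) - force lam σ ζ t 0‖ := norm_le_insert' _ _
        _ ≤ L₀ + K * ‖radial R (rot t c)‖ := add_le_add (hL₀ t ht) h2
        _ ≤ L₀ + K * R := by gcongr; exact norm_radial_le hR _
    · simp [max_eq_left hT.le]
  obtain ⟨U, hU0, hU⟩ := hPL.exists_eq_forall_mem_Icc_hasDerivWithinAt₀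
  exact ⟨U, hU0, hU⟩

/-! ### A priori energy bound and removal of the truncation -/

/-- The energy `½ ‖ψ‖² + ¼ ∫ v⁴`. -/
def energy (c : Seq) : ℝ := ‖c‖ ^ 2 / 2 + quartic c / 4

theorem energy_nonneg (c : Seq) : 0 ≤ energy c := by
  have := quartic_nonneg c
  unfold energy; positivity

/-- The energy estimate: the rate of change of the energy is at most linear in the energy. -/
theorem exists_energy_rate_le (lam σ : ℝ) {ζ : ℝ → Seq} {T Z : ℝ}
    (hZ : ∀ t ∈ Icc 0 T, ∀ᵐ x ∂(volume : Measure Torus), |smooth (ζ t) x| ≤ Z) :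
    ∃ C : ℝ, 0 ≤ C ∧ ∀ t ∈ Icc 0 T, ∀ ψ : Seq,
      inner ℝ (vel ψ) (tri ψ ψ ψ - force lam σ ζ t ψ) ≤ C * (energy ψ + 1) := by
  obtain ⟨K, hK, h⟩ := exists_norm_wickCube_sub_cube_le σ Z
  refine ⟨2 * |lam - 1| + 1 + 2 * K, by positivity, fun t ht ψ => ?_⟩
  have h1 := h ψ (ζ t) (hZ t ht)
  set n := wickCube σ (ψ + ζ t) - tri ψ ψ ψ with hn
  have e : tri ψ ψ ψ - force lam σ ζ t ψ = -(vel ψ + (lam - 1) • smooth ψ + n) := by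
    rw [hn, force]; abel
  have hq := quartic_nonneg ψ
  have hw := norm_vel_le ψ
  have hv := norm_smooth_le ψ
  have i1 : -(inner ℝ (vel ψ) (smooth ψ) * (lam - 1)) ≤ |lam - 1| * ‖ψ‖ ^ 2 := by
    have h2 : |inner ℝ (vel ψ) (smooth ψ)| ≤ ‖ψ‖ ^ 2 :=
      (abs_real_inner_le_norm _ _).trans (by rw [sq]; gcongr)
    calc _ ≤ |inner ℝ (vel ψ) (smooth ψ) * (lam - 1)| := neg_le_abs _
      _ = |lam - 1| * |inner ℝ (vel ψ) (smooth ψ)| := by rw [abs_mul, mul_comm]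
      _ ≤ _ := by gcongr
  have i2 : -(inner ℝ (vel ψ) n) ≤ ‖ψ‖ ^ 2 / 2 + K * (1 + quartic ψ) / 2 := by
    have h2 : -(inner ℝ (vel ψ) n) ≤ ‖ψ‖ * ‖n‖ :=
      (neg_le_abs _).trans ((abs_real_inner_le_norm _ _).trans (by gcongr))
    nlinarith [sq_nonneg (‖ψ‖ - ‖n‖)]
  rw [e, inner_neg_right, inner_add_right, inner_add_right, real_inner_smul_right,
    real_inner_self_eq_norm_sq, energy]
  have hp : 0 ≤ |lam - 1| * quartic ψ := by positivity
  have hkp : 0 ≤ K * ‖ψ‖ ^ 2 := by positivity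
  have hkq : 0 ≤ K * quartic ψ := by positivity
  -- The damping contributes `-‖∂_t v‖²`, which is dropped. In the constant, `C/2` covers the
  -- coefficient of `‖ψ‖²` and `C/4` that of the quartic energy.
  nlinarith [sq_nonneg ‖vel ψ‖, abs_nonneg (lam - 1)]

/-- The a priori bound for the truncated equation, as long as the truncation is not active. -/
theorem energy_le_of_evolves_trunc {lam σ : ℝ} {ζ : ℝ → Seq} {T : ℝ} (hT : 0 < T) {C : ℝ}
    (hC : ∀ t ∈ Icc 0 T, ∀ ψ : Seq,
      inner ℝ (vel ψ) (tri ψ ψ ψ - force lam σ ζ t ψ) ≤ C * (energy ψ + 1))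
    {R : ℝ} (hR : 0 < R) {U : ℝ → Seq}
    (hU : Evolves T (fun t => force lam σ ζ t (radial R (rot t (U t)))) U)
    {t₁ : ℝ} (ht₁ : t₁ ∈ Icc 0 T) (hb : ∀ t ∈ Ioo 0 t₁, ‖U t‖ ≤ R) :
    energy (rot t₁ (U t₁)) + 1 ≤ (energy (U 0) + 1) * Real.exp (C * t₁) := by
  set E : ℝ → ℝ := fun s => ‖U s‖ ^ 2 / 2 + quartic (rot s (U s)) / 4 with hE
  have hEe : ∀ s, energy (rot s (U s)) = E s := fun s => by rw [energy, norm_rot]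
  set E' : ℝ → ℝ := fun t => inner ℝ (vel (rot t (U t))) (tri (rot t (U t)) (rot t (U t))
    (rot t (U t)) - force lam σ ζ t (radial R (rot t (U t)))) with hE'
  have hd : ∀ t ∈ Icc 0 T, HasDerivWithinAt E (E' t) (Icc 0 T) t := fun t ht =>
    hU.hasDeriv_energy hT ht
  have hexp : ∀ t, HasDerivAt (fun s => Real.exp (-(C * s))) (Real.exp (-(C * t)) * (-(C * 1))) t :=
    fun t => (((hasDerivAt_id t).const_mul C).neg).exp
  have hsub : Icc 0 t₁ ⊆ Icc 0 T := Icc_subset_Icc_right ht₁.2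
  -- Grönwall in monotone form. The rate is needed only in the interior, so no bound on `U` at `t₁`
  -- itself is assumed: exactly what a first exit time provides.
  have hanti : AntitoneOn (fun s => (E s + 1) * Real.exp (-(C * s))) (Icc 0 t₁) := by
    refine antitoneOn_of_hasDerivWithinAt_nonpos (convex_Icc _ _)
      (f' := fun t => E' t * Real.exp (-(C * t)) + (E t + 1) * (Real.exp (-(C * t)) * (-(C * 1))))
      ?_ ?_ ?_
    · intro t ht
      exact ((((hd t (hsub ht)).add_const 1).mul
        (hexp t).hasDerivWithinAt).continuousWithinAt).mono hsub
    · intro t ht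
      have hsub' : interior (Icc 0 t₁) ⊆ Icc 0 T := interior_subset.trans hsub
      exact (((hd t (hsub' ht)).add_const 1).mul (hexp t).hasDerivWithinAt).mono hsub'
    · intro t ht
      rw [interior_Icc] at ht
      have htT : t ∈ Icc 0 T := hsub (Ioo_subset_Icc_self ht)
      have hr : radial R (rot t (U t)) = rot t (U t) :=
        radial_of_norm_le hR (by rw [norm_rot]; exact hb t ht)
      have h1 := hC t htT (rot t (U t))
      rw [hEe] at h1
      have h2 : E' t ≤ C * (E t + 1) := by rw [hE']; simp only [hr]; exact h1
      have h3 := Real.exp_pos (-(C * t))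
      have h4 : E' t * Real.exp (-(C * t)) + (E t + 1) * (Real.exp (-(C * t)) * (-(C * 1)))
          = (E' t - C * (E t + 1)) * Real.exp (-(C * t)) := by ring
      rw [h4]
      exact mul_nonpos_of_nonpos_of_nonneg (by linarith) h3.le
  have h := hanti (left_mem_Icc.mpr ht₁.1) (right_mem_Icc.mpr ht₁.1) ht₁.1
  simp only [mul_zero, neg_zero, Real.exp_zero, mul_one] at h
  have h0 : E 0 = energy (U 0) := by rw [← hEe, rot_zero]
  rw [h0] at h
  rw [hEe]
  calc E t₁ + 1 = (E t₁ + 1) * Real.exp (-(C * t₁)) * Real.exp (C * t₁) := by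
        rw [mul_assoc, ← Real.exp_add, neg_add_cancel, Real.exp_zero, mul_one]
    _ ≤ _ := mul_le_mul_of_nonneg_right h (Real.exp_pos _).le

/-- The first-order equation has a solution on `[0,T]`. -/
theorem exists_evolves (lam σ : ℝ) {ζ : ℝ → Seq} (hζ : Continuous ζ) {T Z : ℝ} (hT : 0 < T)
    (hZ : ∀ t ∈ Icc 0 T, ∀ᵐ x ∂(volume : Measure Torus), |smooth (ζ t) x| ≤ Z) (ψ₀ : Seq) :
    ∃ U : ℝ → Seq, U 0 = ψ₀ ∧ Evolves T (fun t => force lam σ ζ t (rot t (U t))) U := by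
  obtain ⟨C, hC0, hC⟩ := exists_energy_rate_le lam σ hZ
  set A : ℝ := (energy ψ₀ + 1) * Real.exp (C * T) with hA
  have hApos : 0 < A := mul_pos (by linarith [energy_nonneg ψ₀]) (Real.exp_pos _)
  -- The a priori bound reads `½‖U‖² + 1 ≤ A`; the extra 1 makes `‖U‖ < R` strict, as the continuity
  -- argument requires.
  set R : ℝ := √(2 * A) with hRdef
  have hR : 0 < R := Real.sqrt_pos.mpr (by positivity)
  have hRsq : R ^ 2 = 2 * A := Real.sq_sqrt (by positivity)
  obtain ⟨U, hU0, hU⟩ := exists_evolves_trunc lam σ hζ hT hR ψ₀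
  have hlt : ∀ t₁ ∈ Icc 0 T, (∀ t ∈ Ioo 0 t₁, ‖U t‖ ≤ R) → ‖U t₁‖ < R := by
    intro t₁ ht₁ hb
    have h1 := energy_le_of_evolves_trunc hT hC hR hU ht₁ hb
    have h2 : (energy (U 0) + 1) * Real.exp (C * t₁) ≤ A := by
      rw [hU0, hA]
      have := energy_nonneg ψ₀
      gcongr
      exact ht₁.2
    have h3 : ‖U t₁‖ ^ 2 / 2 ≤ energy (rot t₁ (U t₁)) := by
      have := quartic_nonneg (rot t₁ (U t₁))
      rw [energy, norm_rot]; linarith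
    refine lt_of_pow_lt_pow_left₀ 2 hR.le ?_
    rw [hRsq]; linarith
  have hall : ∀ t ∈ Icc 0 T, ‖U t‖ < R := by
    by_contra! hcon
    obtain ⟨t₂, ht₂, hbad⟩ := hcon
    -- If the norm reached `R`, there would be a first such time by compactness. Before it the
    -- cutoff is inactive, so the strict bound holds there too.
    set S : Set ℝ := {t ∈ Icc 0 T | R ≤ ‖U t‖} with hS
    have hScl : IsClosed S :=
      hU.continuousOn.norm.preimage_isClosed_of_isClosed isClosed_Icc isClosed_Ici
    have hScomp : IsCompact S := isCompact_Icc.of_isClosed_subset hScl fun t ht => ht.1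
    have hmem := hScomp.sInf_mem ⟨t₂, ht₂, hbad⟩
    refine absurd (hlt (sInf S) hmem.1 fun t ht => ?_) (not_lt.mpr hmem.2)
    by_contra! hgt
    have htS : t ∈ S := ⟨⟨ht.1.le, ht.2.le.trans hmem.1.2⟩, hgt.le⟩
    exact absurd (csInf_le hScomp.bddBelow htS) (not_le.mpr ht.2)
  refine ⟨U, hU0, fun t ht => ?_⟩
  have h := hU t ht
  beta_reduce at h ⊢
  rwa [radial_of_norm_le hR (by rw [norm_rot]; exact (hall t ht).le)] at h

/-! ### The propagator -/

/-- The three sign cases are needed because `λ - 1/4 + |n|²` may be nonpositive; all later arguments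
use only the ODE, not the formulas. -/
theorem exists_deriv_sinRoot (a : ℝ) : ∃ c : ℝ → ℝ, c 0 = 1 ∧ sinRoot a 0 = 0 ∧
    (∀ t, HasDerivAt (sinRoot a) (c t) t) ∧ ∀ t, HasDerivAt c (-a * sinRoot a t) t := by
  rcases lt_trichotomy 0 a with ha | rfl | ha
  · have hs : 0 < √a := Real.sqrt_pos.mpr ha
    have hsq : √a * √a = a := Real.mul_self_sqrt ha.le
    have e : sinRoot a = fun t => Real.sin (t * √a) / √a := by ext t; simp [sinRoot, ha]
    rw [e]
    refine ⟨fun t => Real.cos (t * √a), by simp, by simp, fun t => ?_, fun t => ?_⟩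
    · refine (((hasDerivAt_id t).mul_const (√a)).sin.div_const (√a)).congr_deriv ?_
      simp only [id]; field_simp
    · refine (((hasDerivAt_id t).mul_const (√a)).cos).congr_deriv ?_
      simp only [id]; field_simp; linear_combination -Real.sin (t * √a) * hsq
  · have e : sinRoot 0 = fun t => t := by ext t; simp [sinRoot]
    rw [e]
    refine ⟨fun _ => 1, rfl, rfl, fun t => hasDerivAt_id t, fun t => ?_⟩
    exact (hasDerivAt_const t (1 : ℝ)).congr_deriv (by ring)
  · have hs : 0 < √(-a) := Real.sqrt_pos.mpr (by linarith)
    have hsq : √(-a) * √(-a) = -a := Real.mul_self_sqrt (by linarith)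
    have e : sinRoot a = fun t => Real.sinh (t * √(-a)) / √(-a) := by
      ext t; simp [sinRoot, ha.ne, not_lt.mpr ha.le]
    rw [e]
    refine ⟨fun t => Real.cosh (t * √(-a)), by simp, by simp, fun t => ?_, fun t => ?_⟩
    · refine (((hasDerivAt_id t).mul_const (√(-a))).sinh.div_const (√(-a))).congr_deriv ?_
      simp only [id]; field_simp
    · refine (((hasDerivAt_id t).mul_const (√(-a))).cosh).congr_deriv ?_
      simp only [id]; field_simp; linear_combination Real.sinh (t * √(-a)) * hsq

theorem exists_deriv_propSymbol (lam : ℝ) (n : Freq) : ∃ d : ℝ → ℝ, d 0 = 1 ∧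
    propSymbol lam n 0 = 0 ∧ (∀ t, HasDerivAt (propSymbol lam n) (d t) t) ∧
    ∀ t, HasDerivAt d (-d t - (lam + freqSq n) * propSymbol lam n t) t := by
  obtain ⟨c, hc0, hs0, hs, hc⟩ := exists_deriv_sinRoot (lam - 1 / 4 + freqSq n)
  have he : ∀ t : ℝ, HasDerivAt (fun t => Real.exp (-t / 2)) (Real.exp (-t / 2) * (-1 / 2)) t :=
    fun t => (((hasDerivAt_id t).neg).div_const 2).exp
  refine ⟨fun t => Real.exp (-t / 2) * (c t - sinRoot (lam - 1 / 4 + freqSq n) t / 2),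
    by simp only [hc0, hs0]; simp, by rw [propSymbol, hs0, mul_zero], fun t => ?_, fun t => ?_⟩
  · refine ((he t).mul (hs t)).congr_deriv ?_
    ring
  · refine ((he t).mul ((hc t).sub ((hs t).div_const 2))).congr_deriv ?_
    simp only [propSymbol, Pi.sub_apply]
    ring

theorem continuous_propSymbol (lam : ℝ) (n : Freq) : Continuous (propSymbol lam n) := by
  obtain ⟨d, -, -, h, -⟩ := exists_deriv_propSymbol lam n
  exact continuous_iff_continuousAt.mpr fun t => (h t).continuousAt

theorem continuous_deriv_propSymbol (lam : ℝ) (n : Freq) :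
    Continuous (deriv (propSymbol lam n)) := by
  obtain ⟨d, -, -, h, h'⟩ := exists_deriv_propSymbol lam n
  have e : deriv (propSymbol lam n) = d := funext fun t => (h t).deriv
  rw [e]
  exact continuous_iff_continuousAt.mpr fun t => (h' t).continuousAt

/-- Variation of parameters for the damped oscillator. -/
theorem duhamel_of_hasDerivWithinAt {lam T : ℝ} {n : Freq} {x y F : ℝ → ℂ}
    (hF : ContinuousOn F (Icc 0 T))
    (hx : ∀ t ∈ Icc 0 T, HasDerivWithinAt x (y t) (Icc 0 T) t)
    (hy : ∀ t ∈ Icc 0 T, HasDerivWithinAt y (-y t - ((lam + freqSq n : ℝ) : ℂ) * x t - F t)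
      (Icc 0 T) t) {t : ℝ} (ht : t ∈ Icc 0 T) :
    x t = linearFlow lam n (x 0) (y 0) t
      - ∫ s in (0 : ℝ)..t, (propSymbol lam n (t - s) : ℂ) * F s := by
  obtain ⟨d, hd0, hp0, hp, hd⟩ := exists_deriv_propSymbol lam n
  have hsub : Icc 0 t ⊆ Icc 0 T := Icc_subset_Icc_right ht.2
  -- `Φ s` carries the state at time `s` to time `t` by the linear flow. The homogeneous parts
  -- cancel in its derivative and only the forcing remains; `Φ t` is `x t`, and `Φ 0` is the linear
  -- solution.
  set Φ : ℝ → ℂ := fun s => (d (t - s) : ℂ) * x s + (propSymbol lam n (t - s) : ℂ) * (x s + y s)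
    with hΦ
  have hr : ∀ s : ℝ, HasDerivAt (fun s : ℝ => t - s) (-1) s := fun s =>
    ((hasDerivAt_id s).const_sub t)
  have hΦd : ∀ s ∈ Icc 0 T, HasDerivWithinAt Φ (-((propSymbol lam n (t - s) : ℂ) * F s))
      (Icc 0 T) s := by
    intro s hs
    have h1 := ((hd (t - s)).comp s (hr s)).ofReal_comp.hasDerivWithinAt (s := Icc 0 T)
    have h2 := ((hp (t - s)).comp s (hr s)).ofReal_comp.hasDerivWithinAt (s := Icc 0 T)
    refine ((h1.mul (hx s hs)).add (h2.mul ((hx s hs).add (hy s hs)))).congr_deriv ?_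
    simp only [Function.comp_apply, Pi.add_apply]
    push_cast
    ring
  have hcont : ContinuousOn (fun s => -((propSymbol lam n (t - s) : ℂ) * F s)) (Icc 0 t) := by
    refine ContinuousOn.neg (ContinuousOn.mul ?_ (hF.mono hsub))
    exact (Complex.continuous_ofReal.comp
      ((continuous_propSymbol lam n).comp (continuous_const.sub continuous_id))).continuousOn
  have hint := intervalIntegral.integral_eq_sub_of_hasDerivAt_of_le (f := Φ) ht.1
    (fun s hs => ((hΦd s (hsub hs)).continuousWithinAt).mono hsub)
    (fun s hs => (hΦd s (hsub (Ioo_subset_Icc_self hs))).hasDerivAt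
      (Icc_mem_nhds hs.1 (hs.2.trans_le ht.2)))
    (by
      refine ContinuousOn.intervalIntegrable ?_
      rwa [uIcc_of_le ht.1])
  rw [intervalIntegral.integral_neg] at hint
  simp only [hΦ, sub_self, hd0, hp0, sub_zero, Complex.ofReal_one, one_mul, Complex.ofReal_zero,
    zero_mul, add_zero] at hint
  rw [linearFlow, (hp t).deriv]
  linear_combination -hint

/-- The propagator gains one derivative, uniformly on bounded time intervals. -/
theorem exists_jb_mul_propSymbol_le {lam : ℝ} (hlam : 0 < lam) (T : ℝ) :
    ∃ C : ℝ, ∀ t ∈ Icc 0 T, ∀ n : Freq, ‖((jb n * propSymbol lam n t : ℝ) : ℂ)‖ ≤ C := by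
  obtain ⟨C, hC⟩ := (isCompact_Icc (a := (0 : ℝ)) (b := T)).exists_bound_of_continuousOn
    (continuous_propSymbol lam 0).continuousOn
  refine ⟨max C 2, fun t ht n => ?_⟩
  rw [Complex.norm_real]
  -- At the zero mode `λ - 1/4` can have either sign, so that mode is bounded by compactness in
  -- time; at all others `|n|² ≥ 1` puts the symbol in the oscillating regime.
  by_cases hn : n = 0
  · subst hn
    have : jb 0 = 1 := by simp [jb, freqSq]
    rw [this, one_mul]
    exact (hC t ht).trans (le_max_left _ _)
  · refine le_trans ?_ (le_max_right _ _)
    have hf : 1 ≤ freqSq n := by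
      have h0 : n 0 ≠ 0 ∨ n 1 ≠ 0 := by
        by_contra! hc
        exact hn (by ext i; fin_cases i <;> simp [hc])
      have hz : (1 : ℤ) ≤ n 0 ^ 2 + n 1 ^ 2 := by
        rcases h0 with h | h
        · have := sq_pos_of_ne_zero (R := ℤ) h |> Int.add_one_le_of_lt
          nlinarith [sq_nonneg (n 1)]
        · have := sq_pos_of_ne_zero (R := ℤ) h |> Int.add_one_le_of_lt
          nlinarith [sq_nonneg (n 0)]
      unfold freqSq
      exact_mod_cast hz
    set a := lam - 1 / 4 + freqSq n with ha
    have hapos : 0 < a := by rw [ha]; linarith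
    have hj := jb_pos n
    -- This is `1 + |n|² ≤ 4(λ - 1/4 + |n|²)`, which follows from `|n|² ≥ 1` and `λ > 0`.
    have hsa : jb n ≤ 2 * √a := by
      have h4 : 2 * √a = √(4 * a) := by
        rw [Real.sqrt_mul (by norm_num), show (4 : ℝ) = 2 ^ 2 by norm_num,
          Real.sqrt_sq (by norm_num)]
      rw [h4, jb]
      exact Real.sqrt_le_sqrt (by rw [ha]; linarith)
    have hs : 0 < √a := Real.sqrt_pos.mpr hapos
    have hexp : Real.exp (-t / 2) ≤ 1 := Real.exp_le_one_iff.mpr (by linarith [ht.1])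
    rw [propSymbol, ← ha, sinRoot, if_pos hapos, Real.norm_eq_abs, abs_mul, abs_mul, abs_div,
      abs_of_pos hj, abs_of_pos (Real.exp_pos _), abs_of_pos hs]
    calc jb n * (Real.exp (-t / 2) * (|Real.sin (t * √a)| / √a))
        ≤ (2 * √a) * (1 * (1 / √a)) := by
          gcongr
          exact Real.abs_sin_le_one _
      _ = 2 := by field_simp

/-! ### `H¹` norms -/

theorem sobolevENorm_one_eq {f : L2} {c : Seq} (h : ∀ n, c n = (jb n : ℂ) * coeff f n) :
    sobolevENorm 1 f = ENNReal.ofReal ‖c‖ := by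
  have h1 : ∀ n, (1 + freqSq n) ^ (1 : ℝ) * ‖coeff f n‖ ^ 2 = ‖c n‖ ^ 2 := by
    intro n
    rw [h, norm_mul, mul_pow, Complex.norm_real, Real.norm_eq_abs, sq_abs, jb_sq, Real.rpow_one]
  have h2 := seq_hasSum_sq c
  rw [sobolevENorm]
  simp only [h1]
  rw [← ENNReal.ofReal_tsum_of_nonneg (fun n => by positivity) h2.summable, h2.tsum_eq,
    ENNReal.ofReal_rpow_of_nonneg (by positivity) (by norm_num), ← Real.sqrt_eq_rpow,
    Real.sqrt_sq (norm_nonneg _)]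

theorem exists_lift {f : L2} (hf : MemSobolev 1 f) :
    ∃ c : Seq, ∀ n, c n = (jb n : ℂ) * coeff f n := by
  have h1 : ∀ n, ‖(jb n : ℂ) * coeff f n‖ ^ 2 = (1 + freqSq n) ^ (1 : ℝ) * ‖coeff f n‖ ^ 2 := by
    intro n
    rw [norm_mul, mul_pow, Complex.norm_real, Real.norm_eq_abs, sq_abs, jb_sq, Real.rpow_one]
  refine ⟨⟨fun n => (jb n : ℂ) * coeff f n, memℓp_two_of_summable ?_⟩, fun n => rfl⟩
  simp only [h1]
  have h2 : ∑' n : Freq, ENNReal.ofReal ((1 + freqSq n) ^ (1 : ℝ) * ‖coeff f n‖ ^ 2) ≠ ∞ := by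
    intro htop
    rw [MemSobolev, sobolevENorm, htop] at hf
    simp at hf
  refine (ENNReal.summable_toReal h2).congr fun n => ?_
  rw [ENNReal.toReal_ofReal]
  have := freqSq_nonneg n
  positivity

/-- The coefficients of a real function are conjugate-symmetric, so the real part taken in `smooth`
loses nothing. -/
theorem smooth_of_lift {f : L2} {c : Seq} (h : ∀ n, c n = (jb n : ℂ) * coeff f n) :
    smooth c = f := by
  refine L2_ext_coeff fun n => ?_
  have hj : (jb n : ℂ) ≠ 0 := by exact_mod_cast (jb_pos n).ne'
  rw [coeff_smooth, h, h, coeff_neg, jb_neg, map_mul, Complex.conj_conj, Complex.conj_ofReal]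
  push_cast
  field_simp
  ring

/-- The norm of `c` itself would be too large in general: `smooth` sees only the conjugate-symmetric
part of `c`, whose norm is that of `synth c`. -/
theorem sobolevENorm_smooth (c : Seq) :
    sobolevENorm 1 (smooth c) = ENNReal.ofReal ‖synth c‖ := by
  rw [sobolevENorm_one_eq (c := fourierSeq (synth c)), LinearIsometry.norm_map]
  intro n
  rw [fourierSeq_apply, jb_mul_coeff_smooth]

theorem memSobolev_smooth (c : Seq) : MemSobolev 1 (smooth c) := by
  rw [MemSobolev, sobolevENorm_smooth]
  exact ENNReal.ofReal_lt_top

theorem memX1_of_evolves {T : ℝ} (hT : 0 < T) {f : ℝ → L2} {U : ℝ → Seq} (h : Evolves T f U) :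
    MemX1 T (fun t => smooth (rot t (U t))) where
  mem_H1 t _ := memSobolev_smooth _
  cont_H1 t ht := by
    have h1 : Tendsto (fun s => rot s (U s)) (𝓝[Icc 0 T] t) (𝓝 (rot t (U t))) :=
      h.continuousOn_rot t ht
    have h2 : Tendsto (fun s => ‖synth (rot s (U s) - rot t (U t))‖) (𝓝[Icc 0 T] t) (𝓝 0) := by
      have h3 := ((synth.continuous.tendsto _).comp (h1.sub_const (rot t (U t)))).norm
      simpa [Function.comp_def] using h3
    have h4 := ENNReal.tendsto_ofReal h2
    rw [ENNReal.ofReal_zero] at h4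
    refine h4.congr fun s => ?_
    rw [← map_sub, sobolevENorm_smooth]
  contDiff_L2 := by
    have hd : ∀ t ∈ Icc 0 T, HasDerivWithinAt (fun s => smooth (rot s (U s)))
      (vel (rot t (U t))) (Icc 0 T) t := fun t ht => h.hasDeriv_smooth hT ht
    rw [contDiffOn_one_iff_derivWithin (uniqueDiffOn_Icc hT)]
    refine ⟨fun t ht => (hd t ht).differentiableWithinAt, ?_⟩
    refine (vel.continuous.comp_continuousOn h.continuousOn_rot).congr fun t ht => ?_
    exact (hd t ht).derivWithin (uniqueDiffOn_Icc hT t ht)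

/-- The map `f ↦ ⟨n⟩ f̂(n)` is an isometry from `H¹` to `ℓ²`, so it carries `H¹` continuity over.
This brings an arbitrary competitor, not built by the ODE, into the uniqueness argument. -/
theorem MemX1.exists_lift {T : ℝ} {w : ℝ → L2} (hw : MemX1 T w) :
    ∃ ξ : ℝ → Seq, ContinuousOn ξ (Icc 0 T) ∧
      ∀ t ∈ Icc 0 T, ∀ n, ξ t n = (jb n : ℂ) * coeff (w t) n := by
  classical
  choose! ξ hξ using fun t (ht : t ∈ Icc 0 T) => TrivSNLW.exists_lift (hw.mem_H1 t ht)
  refine ⟨ξ, fun t ht => ?_, hξ⟩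
  have h1 := (ENNReal.tendsto_toReal ENNReal.zero_ne_top).comp (hw.cont_H1 t ht)
  rw [ContinuousWithinAt, tendsto_iff_norm_sub_tendsto_zero]
  refine h1.congr' ?_
  filter_upwards [self_mem_nhdsWithin] with s hs
  have h2 : sobolevENorm 1 (w s - w t) = ENNReal.ofReal ‖ξ s - ξ t‖ := by
    refine sobolevENorm_one_eq fun n => ?_
    rw [lp.coeFn_sub, Pi.sub_apply, hξ s hs, hξ t ht, ← coeffL_apply, ← coeffL_apply,
      ← coeffL_apply, map_sub, mul_sub]
  rw [Function.comp_apply, h2, ENNReal.toReal_ofReal (norm_nonneg _)]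

/-! ### Uniqueness for the Duhamel formulation -/

theorem eq_zero_of_le_mul_integral {T K : ℝ} (hT : 0 < T) {φ : ℝ → ℝ}
    (hφ : ContinuousOn φ (Icc 0 T)) (h0 : ∀ t ∈ Icc 0 T, 0 ≤ φ t)
    (h : ∀ t ∈ Icc 0 T, φ t ≤ K * ∫ s in (0 : ℝ)..t, φ s) : ∀ t ∈ Icc 0 T, φ t = 0 := by
  set φ' : ℝ → ℝ := IccExtend hT.le ((Icc 0 T).domRestrict φ) with hφ'
  have hc : Continuous φ' := (continuousOn_iff_continuous_domRestrict.mp hφ).Icc_extend'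
  have he : ∀ t ∈ Icc 0 T, φ' t = φ t := fun t ht => IccExtend_of_mem _ _ ht
  have hi : ∀ t ∈ Icc 0 T, ∫ s in (0 : ℝ)..t, φ s = ∫ s in (0 : ℝ)..t, φ' s := by
    intro t ht
    refine intervalIntegral.integral_congr fun s hs => ?_
    rw [uIcc_of_le ht.1] at hs
    exact (he s ⟨hs.1, hs.2.trans ht.2⟩).symm
  have hd : ∀ t, HasDerivAt (fun t => ∫ s in (0 : ℝ)..t, φ' s) (φ' t) t := fun t =>
    intervalIntegral.integral_hasDerivAt_right (hc.intervalIntegrable _ _)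
      (hc.stronglyMeasurableAtFilter _ _) hc.continuousAt
  -- The inequality is read as a differential inequality for the primitive of `φ`, which vanishes at
  -- 0.
  have hz := eq_zero_of_abs_deriv_le_mul_abs_self_of_eq_zero_right
    (f := fun t => ∫ s in (0 : ℝ)..t, φ' s) (f' := φ') (K := |K|) (a := 0) (b := T)
    (fun t _ => (hd t).continuousAt.continuousWithinAt) (fun t _ => (hd t).hasDerivWithinAt)
    (by simp) (fun t ht => by
      have htI := Ico_subset_Icc_self ht
      have h1 := h t htI
      rw [hi t htI] at h1
      rw [he t htI, Real.norm_eq_abs, abs_of_nonneg (h0 t htI), Real.norm_eq_abs, ← abs_mul]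
      exact h1.trans (le_abs_self _))
  intro t ht
  have h1 := h t ht
  rw [hi t ht, hz t ht, mul_zero] at h1
  exact le_antisymm h1 (h0 t ht)

/-- Two `H¹` paths that satisfy the Duhamel formula with the same data agree. -/
theorem eqOn_of_duhamel {lam σ T : ℝ} (hlam : 0 < lam) (hT : 0 < T) {ζ : ℝ → Seq}
    (hζ : Continuous ζ) {ξ₁ ξ₂ : ℝ → Seq} (h₁ : ContinuousOn ξ₁ (Icc 0 T))
    (h₂ : ContinuousOn ξ₂ (Icc 0 T)) {ℓ : ℝ → Freq → ℂ}
    (e₁ : ∀ t ∈ Icc 0 T, ∀ n, ξ₁ t n = (jb n : ℂ) * (ℓ t n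
      - ∫ s in (0 : ℝ)..t, (propSymbol lam n (t - s) : ℂ) * coeff (wickCube σ (ξ₁ s + ζ s)) n))
    (e₂ : ∀ t ∈ Icc 0 T, ∀ n, ξ₂ t n = (jb n : ℂ) * (ℓ t n
      - ∫ s in (0 : ℝ)..t, (propSymbol lam n (t - s) : ℂ) * coeff (wickCube σ (ξ₂ s + ζ s)) n)) :
    EqOn ξ₁ ξ₂ (Icc 0 T) := by
  obtain ⟨C, hC⟩ := exists_jb_mul_propSymbol_le hlam T
  have hC0 : 0 ≤ C := (norm_nonneg _).trans (hC 0 ⟨le_rfl, hT.le⟩ 0)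
  obtain ⟨M₁, hM₁⟩ := isCompact_Icc.exists_bound_of_continuousOn (h₁.add hζ.continuousOn)
  obtain ⟨M₂, hM₂⟩ := isCompact_Icc.exists_bound_of_continuousOn (h₂.add hζ.continuousOn)
  obtain ⟨K, hK, hLip⟩ := exists_norm_wickCube_sub_le σ (max M₁ M₂)
  set G₁ : ℝ → L2 := fun s => wickCube σ (ξ₁ s + ζ s) with hG₁
  set G₂ : ℝ → L2 := fun s => wickCube σ (ξ₂ s + ζ s) with hG₂
  have hG₁c : ContinuousOn G₁ (Icc 0 T) :=
    (continuous_wickCube σ).comp_continuousOn (h₁.add hζ.continuousOn)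
  have hG₂c : ContinuousOn G₂ (Icc 0 T) :=
    (continuous_wickCube σ).comp_continuousOn (h₂.add hζ.continuousOn)
  -- Time is clamped to `[0,T]` so that the bound `C` holds for every argument, as strong continuity
  -- of multipliers requires. The factor `⟨n⟩` is the derivative gained by the propagator.
  set p : ℝ → Freq → ℂ := fun τ n => ((jb n * propSymbol lam n (projIcc 0 T hT.le τ) : ℝ) : ℂ)
    with hp
  have hpC : ∀ τ n, ‖p τ n‖ ≤ C := fun τ n => hC _ (projIcc 0 T hT.le τ).2 n
  have hpc : ∀ n, Continuous fun τ => p τ n := fun n =>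
    Complex.continuous_ofReal.comp (continuous_const.mul ((continuous_propSymbol lam n).comp
      (continuous_subtype_val.comp continuous_projIcc)))
  have key : ∀ t ∈ Icc 0 T, ‖ξ₁ t - ξ₂ t‖ ≤ C * K * ∫ s in (0 : ℝ)..t, ‖ξ₁ s - ξ₂ s‖ := by
    intro t ht
    have hsub : Icc 0 t ⊆ Icc 0 T := Icc_subset_Icc_right ht.2
    set I : ℝ → Seq := fun s => mult (p (t - s)) ⟨C, hpC (t - s)⟩ (fourierSeq (G₁ s - G₂ s))
      with hI
    have hIc : ContinuousOn I (Icc 0 t) := by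
      intro s hs
      have hF : Tendsto (fun s => fourierSeq (G₁ s - G₂ s)) (𝓝[Icc 0 t] s)
          (𝓝 (fourierSeq (G₁ s - G₂ s))) :=
        (fourierSeq.continuous.tendsto _).comp
          (((hG₁c.sub hG₂c).mono hsub) s hs)
      exact tendsto_mult (fun s n => hpC (t - s) n) (fun n => hpC (t - s) n)
        (fun n => (((hpc n).comp (continuous_const.sub continuous_id)).tendsto s).mono_left
          nhdsWithin_le_nhds) hF
    have hIi : IntervalIntegrable I volume 0 t :=
      ContinuousOn.intervalIntegrable (by rwa [uIcc_of_le ht.1])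
    -- The frequency-wise Duhamel formulas combine into one Bochner integral in `ℓ²`, whose norm can
    -- be estimated under the integral sign; the linear parts cancel.
    have heq : ξ₁ t - ξ₂ t = -∫ s in (0 : ℝ)..t, I s := by
      ext n
      have h3 := (seqEval n).intervalIntegral_comp_comm hIi
      simp only [seqEval_apply] at h3
      rw [lp.coeFn_neg, Pi.neg_apply, ← h3, lp.coeFn_sub, Pi.sub_apply, e₁ t ht, e₂ t ht]
      have hii : ∀ {G : ℝ → L2}, ContinuousOn G (Icc 0 T) → IntervalIntegrable
          (fun s => (propSymbol lam n (t - s) : ℂ) * coeff (G s) n) volume 0 t := by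
        intro G hG
        refine ContinuousOn.intervalIntegrable ?_
        rw [uIcc_of_le ht.1]
        refine ContinuousOn.mul ?_ ?_
        · exact (Complex.continuous_ofReal.comp
            ((continuous_propSymbol lam n).comp (continuous_const.sub continuous_id))).continuousOn
        · have := (coeffL n).continuous.comp_continuousOn (hG.mono hsub)
          simpa only [Function.comp_def, coeffL_apply] using this
      have h4 : ∫ s in (0 : ℝ)..t, I s n = (jb n : ℂ) *
          ((∫ s in (0 : ℝ)..t, (propSymbol lam n (t - s) : ℂ) * coeff (G₁ s) n)
          - ∫ s in (0 : ℝ)..t, (propSymbol lam n (t - s) : ℂ) * coeff (G₂ s) n) := by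
        rw [← intervalIntegral.integral_sub (hii hG₁c) (hii hG₂c),
          ← intervalIntegral.integral_const_mul]
        refine intervalIntegral.integral_congr fun s hs => ?_
        rw [uIcc_of_le ht.1] at hs
        have hts : t - s ∈ Icc 0 T := ⟨by linarith [hs.2], by linarith [hs.1, ht.2]⟩
        simp only [hI, hp, mult_apply, projIcc_of_mem _ hts]
        rw [fourierSeq_apply, ← coeffL_apply, ← coeffL_apply, ← coeffL_apply, map_sub]
        push_cast
        ring
      rw [h4]
      ring
    rw [heq, norm_neg, ← intervalIntegral.integral_const_mul]
    refine intervalIntegral.norm_integral_le_of_norm_le ht.1 (.of_forall fun s hs => ?_) ?_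
    · have hsT : s ∈ Icc 0 T := ⟨hs.1.le, hs.2.trans ht.2⟩
      have h5 := hLip (ξ₁ s + ζ s) (ξ₂ s + ζ s) ((hM₁ s hsT).trans (le_max_left _ _))
        ((hM₂ s hsT).trans (le_max_right _ _))
      rw [add_sub_add_right_eq_sub] at h5
      calc ‖I s‖ ≤ C * ‖fourierSeq (G₁ s - G₂ s)‖ := norm_mult_le (hpC (t - s)) _
        _ = C * ‖G₁ s - G₂ s‖ := by rw [LinearIsometry.norm_map]
        _ ≤ C * (K * ‖ξ₁ s - ξ₂ s‖) := mul_le_mul_of_nonneg_left h5 hC0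
        _ = _ := (mul_assoc _ _ _).symm
    · refine ContinuousOn.intervalIntegrable ?_
      rw [uIcc_of_le ht.1]
      exact (((h₁.sub h₂).norm).mono hsub).const_mul _
  have hz := eq_zero_of_le_mul_integral hT (φ := fun t => ‖ξ₁ t - ξ₂ t‖) (h₁.sub h₂).norm
    (fun _ _ => norm_nonneg _) key
  exact fun t ht => sub_eq_zero.mp (norm_eq_zero.mp (hz t ht))

/-! ### The linear solution as a path of trigonometric polynomials -/

section Linear

variable {Ω : Type*} {g h : Freq → Ω → ℂ} {β : Freq → ℝ≥0 → Ω → ℂ} {a : ℝ} {N : ℕ} {ω : Ω}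

theorem continuous_linearFlow (lam : ℝ) (n : Freq) (a₀ a₁ : ℂ) :
    Continuous (linearFlow lam n a₀ a₁) :=
  ((Complex.continuous_ofReal.comp (continuous_deriv_propSymbol lam n)).mul continuous_const).add
    ((Complex.continuous_ofReal.comp (continuous_propSymbol lam n)).mul continuous_const)

/-- After integration by parts only a parametric integral of a jointly continuous function is left,
so continuity of the path `b` is enough. -/
theorem continuous_wienerIntegral (lam : ℝ) (n : Freq) {b : ℝ≥0 → ℂ} (hb : Continuous b) :
    Continuous fun t => wienerIntegral (fun s => propSymbol lam n (t - s)) b t := by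
  have hder : ∀ t s : ℝ, deriv (fun s => propSymbol lam n (t - s)) s
      = -deriv (propSymbol lam n) (t - s) := fun t s => deriv_comp_const_sub _ _ _
  simp only [wienerIntegral, hder, sub_self, sub_zero]
  have h1 := continuous_propSymbol lam n
  have h2 := continuous_deriv_propSymbol lam n
  have hb' : Continuous fun s : ℝ => b s.toNNReal := hb.comp continuous_real_toNNReal
  refine Continuous.sub (by fun_prop) ?_
  refine intervalIntegral.continuous_parametric_intervalIntegral_of_continuous ?_ continuous_id
  have h3 : Continuous fun p : ℝ × ℝ => ((-deriv (propSymbol lam n) (p.1 - p.2) : ℝ) : ℂ) :=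
    Complex.continuous_ofReal.comp (h2.comp (continuous_fst.sub continuous_snd)).neg
  exact h3.mul (hb'.comp continuous_snd)

theorem continuous_zCoeff {n : Freq} (hb : Continuous fun t => β n t ω) :
    Continuous fun t => zCoeff g h β a N ω t n :=
  (continuous_linearFlow _ _ _ _).add
    (continuous_const.mul (continuous_wienerIntegral _ _ hb))

/-- The sequence `⟨n⟩ ẑ_N(t, n)`. -/
def zSeq (g h : Freq → Ω → ℂ) (β : Freq → ℝ≥0 → Ω → ℂ) (a : ℝ) (N : ℕ) (ω : Ω) (t : ℝ) : Seq :=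
  ∑ n ∈ freqBall N, ((jb n : ℂ) * zCoeff g h β a N ω t n) • lp.single 2 n (1 : ℂ)

theorem continuous_zSeq (hz : ∀ n ∈ freqBall N, Continuous fun t => zCoeff g h β a N ω t n) :
    Continuous (zSeq g h β a N ω) :=
  continuous_finsetSum _ fun n hn =>
    (continuous_const.mul (hz n hn)).smul continuous_const

theorem jInv_smul (z : ℂ) (c : Seq) : jInv (z • c) = z • jInv c := by
  ext n
  rw [jInv_apply, lp.coeFn_smul, lp.coeFn_smul, Pi.smul_apply, Pi.smul_apply, jInv_apply,
    smul_eq_mul, smul_eq_mul]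
  ring

theorem jInv_single (n : Freq) :
    jInv (lp.single 2 n (1 : ℂ)) = (((jb n)⁻¹ : ℝ) : ℂ) • lp.single 2 n (1 : ℂ) := by
  ext m
  rw [jInv_apply, lp.coeFn_smul, Pi.smul_apply, smul_eq_mul]
  by_cases hm : m = n
  · rw [hm]
  · have : (lp.single 2 n (1 : ℂ) : Seq) m = 0 := lp.single_apply_ne _ _ _ hm
    rw [this, mul_zero, mul_zero]

/-- The weight `⟨n⟩` cancels against `⟨∇⟩⁻¹`, and the sum is finite. -/
theorem coeFn_smooth_zSeq (t : ℝ) :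
    smooth (zSeq g h β a N ω t) =ᵐ[volume] zFn g h β a N ω t := by
  have h1 : jInv (zSeq g h β a N ω t)
      = ∑ n ∈ freqBall N, zCoeff g h β a N ω t n • lp.single 2 n (1 : ℂ) := by
    rw [zSeq, map_sum]
    refine Finset.sum_congr rfl fun n _ => ?_
    have hj : (jb n : ℂ) ≠ 0 := by exact_mod_cast (jb_pos n).ne'
    rw [jInv_smul, jInv_single, smul_smul]
    congr 1
    push_cast
    field_simp
  have h2 : torusBasis.repr.symm (jInv (zSeq g h β a N ω t))
      = ∑ n ∈ freqBall N, zCoeff g h β a N ω t n • torusBasis n := by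
    rw [h1, map_sum]
    refine Finset.sum_congr rfl fun n _ => ?_
    rw [map_smul, torusBasis.repr_symm_single]
  have h3 : ∀ᵐ x ∂(volume : Measure Torus), ∀ n, torusBasis n x = basisFn n x :=
    ae_all_iff.mpr fun n => coeFn_torusBasis n
  have h4 : ∀ᵐ x ∂(volume : Measure Torus), ∀ n, (zCoeff g h β a N ω t n • torusBasis n :
      Lp ℂ 2 (volume : Measure Torus)) x = zCoeff g h β a N ω t n * torusBasis n x :=
    ae_all_iff.mpr fun n => by
      filter_upwards [Lp.coeFn_smul (zCoeff g h β a N ω t n) (torusBasis n)] with x hx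
      rw [hx]; rfl
  filter_upwards [coeFn_reL2 (torusBasis.repr.symm (jInv (zSeq g h β a N ω t))), h3, h4,
    Lp.coeFn_finsetSum (freqBall N) fun n => zCoeff g h β a N ω t n • torusBasis n]
    with x e1 e2 e3 e4
  rw [smooth_apply, synth_apply, e1, h2, e4, Finset.sum_apply, zFn]
  congr 1
  refine Finset.sum_congr rfl fun n _ => ?_
  rw [e3, e2]

theorem exists_abs_zFn_le (hz : ∀ n ∈ freqBall N, Continuous fun t => zCoeff g h β a N ω t n)
    (T : ℝ) : ∃ Z : ℝ, ∀ t ∈ Icc 0 T, ∀ x, |zFn g h β a N ω t x| ≤ Z := by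
  have hc : Continuous fun t => ∑ n ∈ freqBall N, ‖zCoeff g h β a N ω t n‖ :=
    continuous_finsetSum _ fun n hn => (hz n hn).norm
  obtain ⟨Z, hZ⟩ := (isCompact_Icc (a := (0 : ℝ)) (b := T)).exists_bound_of_continuousOn
    hc.continuousOn
  refine ⟨Z, fun t ht x => ((Complex.abs_re_le_norm _).trans (norm_sum_le _ _)).trans
    (le_trans (Finset.sum_le_sum fun n _ => ?_) ((le_abs_self _).trans (hZ t ht)))⟩
  rw [norm_mul, norm_basisFn]
  exact mul_le_of_le_one_right (norm_nonneg _)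
    (inv_le_one_of_one_le₀ (by linarith [Real.pi_gt_three]))

/-- The binomial identity for Hermite polynomials: the four terms of the forcing are the expansion
of `(v + z)³ - 3σ(v + z)`. -/
theorem coeff_forcing {v : ℝ → L2} {s : ℝ} {ξ : Seq} (hv : smooth ξ = v s) (n : Freq) :
    coeff (forcing g h β a N ω v s) n
      = coeff (wickCube (wickVar a N) (ξ + zSeq g h β a N ω s)) n := by
  refine coeff_congr ?_ n
  filter_upwards [coeFn_wickCube (wickVar a N) (ξ + zSeq g h β a N ω s),
    Lp.coeFn_add (smooth ξ) (smooth (zSeq g h β a N ω s)),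
    coeFn_smooth_zSeq (g := g) (h := h) (β := β) (a := a) (N := N) (ω := ω) s] with x h1 h2 h3
  rw [h1, map_add, h2, Pi.add_apply, h3, hv, forcing, wickPow, wickPow, hermiteVar_two,
    hermiteVar_three]
  ring

end Linear

/-! ### Deterministic well-posedness and almost sure path continuity -/

theorem renorm_pos {a : ℝ} (ha : a ≠ 0) (N : ℕ) : 0 < renorm a N := by
  rw [renorm, dif_pos ha]
  exact (existsUnique_renorm ha N).exists.choose_spec.1

/-- Deterministic global well-posedness, given the continuity in time of the linear solution. -/
theorem exists_unique_solution {Ω : Type*} {g h : Freq → Ω → ℂ} {β : Freq → ℝ≥0 → Ω → ℂ} {a : ℝ}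
    (ha : a ≠ 0) {N : ℕ} {ω : Ω}
    (hz : ∀ n ∈ freqBall N, Continuous fun t => zCoeff g h β a N ω t n) {T : ℝ} (hT : 0 < T)
    {v₀ : L2} (v₁ : L2) (hv₀ : MemSobolev 1 v₀) :
    ∃ v : ℝ → L2, IsSolution g h β a N ω v₀ v₁ T v ∧
      ∀ w : ℝ → L2, IsSolution g h β a N ω v₀ v₁ T w → EqOn w v (Icc 0 T) := by
  have hlam := renorm_pos ha N
  set lam := renorm a N with hlamdef
  set σ := wickVar a N with hσ
  set ζ := zSeq g h β a N ω with hζdef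
  have hζ : Continuous ζ := continuous_zSeq hz
  obtain ⟨Z, hZ⟩ := exists_abs_zFn_le hz T
  have hZ' : ∀ t ∈ Icc 0 T, ∀ᵐ x ∂(volume : Measure Torus), |smooth (ζ t) x| ≤ Z := by
    intro t ht
    filter_upwards [coeFn_smooth_zSeq (g := g) (h := h) (β := β) (a := a) (N := N) (ω := ω) t]
      with x hx
    rw [hx]
    exact hZ t ht x
  obtain ⟨c₀, hc₀⟩ := exists_lift hv₀
  -- The initial value is `⟨∇⟩v₀ + i v₁`, with `i` written as minus `-i`. Below, `smooth`
  -- annihilates the imaginary part and `vel` the real part, so the data are recovered separately.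
  obtain ⟨U, hU0, hU⟩ := exists_evolves lam σ hζ hT hZ' (c₀ - negI (fourierSeq v₁))
  have hsv : smooth (negI (fourierSeq v₁)) = 0 := by
    refine L2_ext_coeff fun n => ?_
    have h0 : coeff (0 : L2) n = 0 := by rw [← coeffL_apply, map_zero]
    rw [h0, coeff_smooth, negI_apply, negI_apply, fourierSeq_apply, fourierSeq_apply, coeff_neg,
      map_mul, map_neg, Complex.conj_I, Complex.conj_conj]
    ring
  have hvv : vel c₀ = 0 := by
    refine L2_ext_coeff fun n => ?_
    have h0 : coeff (0 : L2) n = 0 := by rw [← coeffL_apply, map_zero]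
    rw [h0, coeff_vel, hc₀, hc₀, coeff_neg, jb_neg, map_mul, Complex.conj_ofReal,
      Complex.conj_conj]
    ring
  have hv1 : vel (negI (fourierSeq v₁)) = -v₁ := by
    have : negI (negI (fourierSeq v₁)) = -fourierSeq v₁ := by
      ext n
      rw [negI_apply, negI_apply, lp.coeFn_neg, Pi.neg_apply, ← mul_assoc, neg_mul_neg,
        Complex.I_mul_I, neg_one_mul]
    rw [vel_apply, this, map_neg, synth_fourierSeq]
  set ψ : ℝ → Seq := fun t => rot t (U t) with hψ
  have hψ0 : ψ 0 = c₀ - negI (fourierSeq v₁) := by rw [hψ]; simp only [rot_zero, hU0]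
  have hx0 : smooth (ψ 0) = v₀ := by rw [hψ0, map_sub, hsv, sub_zero, smooth_of_lift hc₀]
  have hy0 : vel (ψ 0) = v₁ := by rw [hψ0, map_sub, hvv, hv1, zero_sub, neg_neg]
  have hψc : ContinuousOn ψ (Icc 0 T) := hU.continuousOn_rot
  have hsol : IsSolution g h β a N ω v₀ v₁ T (fun t => smooth (ψ t)) := by
    refine ⟨memX1_of_evolves hT hU, fun t ht n => ?_⟩
    have hF : ContinuousOn (fun s => coeff (wickCube σ (ψ s + ζ s)) n) (Icc 0 T) := by
      have h1 := (coeffL n).continuous.comp_continuousOn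
        ((continuous_wickCube σ).comp_continuousOn (hψc.add hζ.continuousOn))
      simpa only [Function.comp_def, coeffL_apply, Pi.add_apply] using h1
    have hd := duhamel_of_hasDerivWithinAt (lam := lam) (n := n)
      (x := fun s => coeff (smooth (ψ s)) n) (y := fun s => coeff (vel (ψ s)) n) hF
      (fun s hs => hU.hasDeriv_coeff_smooth n hs) (fun s hs => by
        refine (hU.hasDeriv_coeff_vel n hs).congr_deriv ?_
        -- The mass 1 in `⟨n⟩²` and the term `(λ - 1)v` of the forcing add up to `λ + |n|²`, and the
        -- forcing also supplies the damping.
        have hj : (jb n : ℂ) ^ 2 = ((1 + freqSq n : ℝ) : ℂ) := by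
          rw [← jb_sq]; push_cast; ring
        rw [hj, ← coeffL_apply n (force _ _ _ _ _), force, map_add, map_add, map_smul,
          coeffL_apply, coeffL_apply, coeffL_apply, Complex.real_smul]
        push_cast
        ring) ht
    simp only [hx0, hy0] at hd
    rw [hd]
    congr 1
    refine intervalIntegral.integral_congr fun s _ => ?_
    rw [coeff_forcing (v := fun t => smooth (ψ t)) (ξ := ψ s) rfl]
  refine ⟨_, hsol, fun w hw => ?_⟩
  have hdu : ∀ (u : ℝ → L2), IsSolution g h β a N ω v₀ v₁ T u → ∀ ξ : ℝ → Seq,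
      (∀ t ∈ Icc 0 T, ∀ n, ξ t n = (jb n : ℂ) * coeff (u t) n) →
      ∀ t ∈ Icc 0 T, ∀ n, ξ t n = (jb n : ℂ) * (linearFlow lam n (coeff v₀ n) (coeff v₁ n) t
        - ∫ s in (0 : ℝ)..t, (propSymbol lam n (t - s) : ℂ)
          * coeff (wickCube σ (ξ s + ζ s)) n) := by
    intro u hu ξ hξ t ht n
    rw [hξ t ht, hu.duhamel t ht n]
    congr 2
    refine intervalIntegral.integral_congr fun s hs => ?_
    rw [uIcc_of_le ht.1] at hs
    rw [coeff_forcing (smooth_of_lift (hξ s ⟨hs.1, hs.2.trans ht.2⟩))]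
  obtain ⟨ξ₁, hc₁, he₁⟩ := hw.memX1.exists_lift
  obtain ⟨ξ₂, hc₂, he₂⟩ := hsol.memX1.exists_lift
  have heq := eqOn_of_duhamel hlam hT hζ hc₁ hc₂ (hdu w hw ξ₁ he₁) (hdu _ hsol ξ₂ he₂)
  intro t ht
  rw [← smooth_of_lift (he₁ t ht), heq ht]
  exact smooth_of_lift (he₂ t ht)

/-- Almost surely, all the Brownian paths are continuous. -/
theorem IsNoise.ae_continuous {Ω : Type*} [MeasurableSpace Ω] {P : Measure Ω}
    {g h : Freq → Ω → ℂ} {β : Freq → ℝ≥0 → Ω → ℂ} (hn : IsNoise P g h β) :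
    ∀ᵐ ω ∂P, ∀ n, Continuous fun t => β n t ω := by
  refine ae_all_iff.mpr fun n => ?_
  by_cases h0 : n = 0
  · subst h0
    filter_upwards [hn.law_β_zero.cont] with ω hω
    have he : (fun t => β 0 t ω) = fun t => (((β 0 t ω).re : ℝ) : ℂ) := by
      ext t
      have := hn.β_neg 0 t ω
      rw [neg_zero] at this
      exact (Complex.conj_eq_iff_re.mp this.symm).symm
    rw [he]
    exact Complex.continuous_ofReal.comp hω
  · filter_upwards [(hn.law_β n h0).1.cont, (hn.law_β n h0).2.1.cont] with ω h1 h2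
    have hs : √(2 : ℝ) ≠ 0 := by positivity
    have he : (fun t => β n t ω) = fun t => (((√2)⁻¹ * (√2 * (β n t ω).re) : ℝ) : ℂ)
        + (((√2)⁻¹ * (√2 * (β n t ω).im) : ℝ) : ℂ) * Complex.I := by
      ext t
      rw [← mul_assoc, ← mul_assoc, inv_mul_cancel₀ hs, one_mul, one_mul, Complex.re_add_im]
    rw [he]
    exact (Complex.continuous_ofReal.comp (continuous_const.mul h1)).add
      ((Complex.continuous_ofReal.comp (continuous_const.mul h2)).mul continuous_const)

end TrivSNLW

end

theorem proposition3p1 {Ω : Type*} [MeasurableSpace Ω] (P : Measure Ω) [IsProbabilityMeasure P]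
    (g h : TrivSNLW.Freq → Ω → ℂ) (β : TrivSNLW.Freq → ℝ≥0 → Ω → ℂ)
    (hnoise : TrivSNLW.IsNoise P g h β)
    (α : ℕ → ℝ) (hα_ne : ∀ N, 1 ≤ N → α N ≠ 0) (hα_bdd : ∃ C : ℝ, ∀ N, 1 ≤ N → |α N| ≤ C)
    (hα_log : Tendsto (fun N : ℕ => α N ^ 2 * Real.log N) atTop atTop)
    (T : ℝ) (hT : 0 < T) :
    ∃ ΩT : Set Ω, MeasurableSet ΩT ∧ P ΩT = 1 ∧
      ∀ ω ∈ ΩT, ∀ N : ℕ, 1 ≤ N →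
        ∀ v₀ v₁ : TrivSNLW.L2, TrivSNLW.MemSobolev 1 v₀ →
          ∃ v : ℝ → TrivSNLW.L2,
            TrivSNLW.IsSolution g h β (α N) N ω v₀ v₁ T v ∧
            ∀ w : ℝ → TrivSNLW.L2,
              TrivSNLW.IsSolution g h β (α N) N ω v₀ v₁ T w → EqOn w v (Icc 0 T) := by
  -- The exceptional set of paths is only known to be null, not measurable, so a measurable null
  -- superset is removed instead. It depends neither on `T` nor on `N` or the data.
  set S : Set Ω := {ω | ¬ ∀ n, Continuous fun t => β n t ω} with hS
  have h0 : P (toMeasurable P S) = 0 := by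
    rw [measure_toMeasurable]
    exact ae_iff.mp hnoise.ae_continuous
  refine ⟨(toMeasurable P S)ᶜ, (measurableSet_toMeasurable P S).compl,
    (prob_compl_eq_one_iff (measurableSet_toMeasurable P S)).mpr h0, ?_⟩
  intro ω hω N hN v₀ v₁ hv₀
  have hc : ∀ n, Continuous fun t => β n t ω := by
    by_contra hcon
    exact hω (subset_toMeasurable P S hcon)
  exact TrivSNLW.exists_unique_solution (hα_ne N hN)
    (fun n _ => TrivSNLW.continuous_zCoeff (hc n)) hT v₁ hv₀
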